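/- **Setting.** Fix a universe $\mathrm{SET}$ of sets. A *duoidal category* is a category $V$ with two monoidal structures $(\otimes,I)$ and $(\star,J)$ such that $\star:V\times V\to V$ and $J:1\to V$ are opmonoidal functors with respect to $\otimes$ (structure morphisms $\xi:(Y\otimes X)\star(Z\otimes W)\to (Y\star Z)\otimes(X\star W)$, $\mu:I\star I\to I$, $\gamma:J\to J\otimes J$, $\nu:J\to I$) and the associator and unitors of $\star$ are opmonoidal transformations. It is *normal* if $\nu:J\to I$ is invertible; we then identify $J$ with $I$ along $\nu$, and write $$\sigma_{XY}:X\star Y\cong (X\otimes I)\star(I\otimes Y)\xrightarrow{\xi}(X\star I)\otimes(I\star Y)\cong X\otimes Y,$$ $$\tau_{XY}:X\star Y\cong (I\otimes X)\star(Y\otimes I)\xrightarrow{\xi}(I\star Y)\otimes(X\star I)\cong Y\otimes X.$$ $V$ is *$\star$-biclosed* if for every $X$ the functors $X\star(-)$ and $(-)\star X$ have right adjoints, written $[X,-]_r$ and $[X,-]_\ell$. For a monoidal category $V$, a (left) *$V$-category* has composition morphisms $m_{ABC}: C(B,C)\otimes C(A,B)\to C(A,C)$. For a $\mathrm{SET}$-small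 monoidal category $V$, let $\hat V=[V^{\mathrm{op}},\mathrm{SET}]$ with Day convolution. A *$V$-graded category* is a $\hat V$-category $C$; equivalently it consists of objects, sets $C(X\mid A;B)$ of graded morphisms $f:X\mid A\to B$ of grade $X\in V$, reindexing $\alpha^*f:Y\mid A\to B$ along $\alpha:Y\to X$ in $V$, composites $g\circ f:Y\otimes X\mid A\to C$ of $f:X\mid A\to B$ and $g:Y\mid B\to C$, and identities $I\mid A\to A$, subject to functoriality of reindexing, naturality of composition, and associativity and unit laws up to reindexing along the constraints of $V$. *$V$-graded functors* are $\hat V$-functors. Every $V$-category $C$ is regarded as $V$-graded, with $C(X\mid A;B)=V(X,C(A,B))$. Let $V$ be normal duoidal. A quadruple $f:X\mid A\to A'$, $g:X\mid B\to B'$, $\phi:X'\mid A\to B$, $\phi':X'\mid A'\to B'$ of graded morphisms in a $V$-graded category, written $(f,g,\phi,\phi')$, is a *$V$-graded square* if $\sigma_{XX'}^*(g\circ\phi)=\tau_{XX'}^*(\phi'\circ f)$. For $V$-graded categories $A,C$, the *$V$-graded functor categories* $[A,C]_r$ and $[A,C]_\ell$ are the $V$-graded categories whose objects are the $V$-graded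 functors $A\to C$ and in which a graded morphism $X'\mid F\to G$ is a family of graded morphisms $\phi_a:X'\mid Fa\to Ga$ $(a\in\mathrm{ob}\,A)$ such that, for every graded morphism $f:X\mid a\to b$ of $A$, the quadruple $(Ff,Gf,\phi_a,\phi_b)$ (respectively $(\phi_a,\phi_b,Ff,Gf)$) is a $V$-graded square; reindexing, composition and identities are those of $C$, objectwise. Let moreover $V$ be complete and $\star$-biclosed, and let $A,C$ be $V$-categories with $A$ small. The *$V$-enriched functor category of Garner and López Franco* $[A,C]^V_r$ has as objects the $V$-functors $A\to C$; its hom-object $[A,C]_r^V(F,G)$ is the limit of the diagram $$C(Fa,Ga)\longrightarrow[A(a,b),C(Fa,Gb)]_r\longleftarrow C(Fb,Gb)\qquad(a,b\in\mathrm{ob}\,A)$$ whose legs are the transposes of $m\cdot(G_{ab}\otimes1)\cdot\sigma:A(a,b)\star C(Fa,Ga)\to C(Fa,Gb)$ and $m\cdot(1\otimes F_{ab})\cdot\tau:A(a,b)\star C(Fb,Gb)\to C(Fa,Gb)$; composition and identities are induced by those of $C$. The $V$-category $[A,C]^V_\ell$ is defined in the same way from the adjoints $[X,-]_\ell$ and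 the transposes of $m\cdot(G_{ab}\otimes1)\cdot\tau:C(Fa,Ga)\star A(a,b)\to C(Fa,Gb)$ and $m\cdot(1\otimes F_{ab})\cdot\sigma:C(Fb,Gb)\star A(a,b)\to C(Fa,Gb)$. **Theorem.** 1. Let $V$ be a $\mathrm{SET}$-small normal duoidal category. (The category $\hat V$, with the Day convolutions of $\otimes$ and of $\star$, is then itself a normal duoidal category that has $\mathrm{SET}$-small limits and is $\star$-biclosed.) For all $V$-graded categories (that is, $\hat V$-categories) $A$ and $C$ with $A$ having a $\mathrm{SET}$-small set of objects, there are isomorphisms of $V$-graded categories $$[A,C]_r^{\hat V}\cong[A,C]_r,\qquad [A,C]_\ell^{\hat V}\cong[A,C]_\ell .$$ 2. Let $V$ be a complete and $\star$-biclosed normal duoidal category, and let $A$ and $C$ be $V$-categories with $A$ small. Then there are isomorphisms of $V$-graded categories $$[A,C]_r^{V}\cong[A,C]_r,\qquad [A,C]_\ell^{V}\cong[A,C]_\ell ,$$ where the $V$-categories $A$, $C$, $[A,C]_r^V$, $[A,C]_\ell^V$ are regarded as $V$-graded categories. -/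

import Mathlib

open CategoryTheory MonoidalCategory Limits Opposite

universe u v w x y

namespace DuoidalGraded

/-! ### Duoidal categories -/

/-- A second monoidal structure `(⋆, J)` on the underlying category of a monoidal category
`(V, ⊗, I)`, with its associator `α` and unitors `λ`, `ρ`. -/
class StarMonoidal (V : Type u) [Category.{v} V] where
  star : MonoidalCategory V

section StarNotation

variable {V : Type u} [Category.{v} V] [S : StarMonoidal V]

/-- The object `X ⋆ Y`. -/
abbrev starObj (X Y : V) : V := S.star.tensorObj X Y

/-- The morphism `f ⋆ g`. -/
abbrev starHom {X Y Z W : V} (f : X ⟶ Y) (g : Z ⟶ W) : starObj X Z ⟶ starObj Y W :=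
  S.star.tensorHom f g

variable (V) in
/-- The unit object `J` of `⋆`. -/
abbrev starUnit : V := S.star.tensorUnit

/-- The associator `α` of `⋆`. -/
abbrev starAssoc (X Y Z : V) : starObj (starObj X Y) Z ≅ starObj X (starObj Y Z) :=
  S.star.associator X Y Z

/-- The left unitor `λ` of `⋆`. -/
abbrev starLeftUnitor (X : V) : starObj (starUnit V) X ≅ X := S.star.leftUnitor X

/-- The right unitor `ρ` of `⋆`. -/
abbrev starRightUnitor (X : V) : starObj X (starUnit V) ≅ X := S.star.rightUnitor X

end StarNotation

infixr:70 " ⋆ " => starObj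
infixr:70 " ⋆ₘ " => starHom

/-- A duoidal category `(V, ⊗, ⋆)`: a pseudomonoid in the 2-category of monoidal categories and
opmonoidal functors. In detail, `⋆ : V × V ⥤ V` is opmonoidal (via `ξ`, `μ`), `J : 1 ⥤ V` is
opmonoidal, i.e. a comonoid (via `γ`, `ν`), and the associator and unitors of `⋆` are opmonoidal
transformations. -/
class Duoidal (V : Type u) [Category.{v} V] [MonoidalCategory V] [StarMonoidal V] where
  /-- the interchanger -/
  ξ (Y X Z W : V) : (Y ⊗ X) ⋆ (Z ⊗ W) ⟶ (Y ⋆ Z) ⊗ (X ⋆ W)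
  μ : 𝟙_ V ⋆ 𝟙_ V ⟶ 𝟙_ V
  ν : starUnit V ⟶ 𝟙_ V
  γ : starUnit V ⟶ starUnit V ⊗ starUnit V
  ξ_natural {Y X Z W Y₁ X₁ Z₁ W₁ : V} (f : Y ⟶ Y₁) (g : X ⟶ X₁) (h : Z ⟶ Z₁) (k : W ⟶ W₁) :
    ((f ⊗ₘ g) ⋆ₘ (h ⊗ₘ k)) ≫ ξ Y₁ X₁ Z₁ W₁ = ξ Y X Z W ≫ ((f ⋆ₘ h) ⊗ₘ (g ⋆ₘ k))
  ξ_assoc (A B C A₁ B₁ C₁ : V) :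
    ((α_ A B C).hom ⋆ₘ (α_ A₁ B₁ C₁).hom) ≫ ξ A (B ⊗ C) A₁ (B₁ ⊗ C₁) ≫
        (A ⋆ A₁) ◁ ξ B C B₁ C₁ =
      ξ (A ⊗ B) C (A₁ ⊗ B₁) C₁ ≫ ξ A B A₁ B₁ ▷ (C ⋆ C₁) ≫ (α_ _ _ _).hom
  ξ_leftUnit (A B : V) :
    ξ (𝟙_ V) A (𝟙_ V) B ≫ μ ▷ (A ⋆ B) ≫ (λ_ (A ⋆ B)).hom = (λ_ A).hom ⋆ₘ (λ_ B).hom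
  ξ_rightUnit (A B : V) :
    ξ A (𝟙_ V) B (𝟙_ V) ≫ (A ⋆ B) ◁ μ ≫ (ρ_ (A ⋆ B)).hom = (ρ_ A).hom ⋆ₘ (ρ_ B).hom
  γ_coassoc : γ ≫ γ ▷ starUnit V ≫ (α_ _ _ _).hom = γ ≫ starUnit V ◁ γ
  γ_counit_left : γ ≫ ν ▷ starUnit V ≫ (λ_ (starUnit V)).hom = 𝟙 (starUnit V)
  γ_counit_right : γ ≫ starUnit V ◁ ν ≫ (ρ_ (starUnit V)).hom = 𝟙 (starUnit V)
  starAssoc_ξ (A B A₁ B₁ A₂ B₂ : V) :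
    (ξ A B A₁ B₁ ⋆ₘ 𝟙 (A₂ ⊗ B₂)) ≫ ξ (A ⋆ A₁) (B ⋆ B₁) A₂ B₂ ≫
        ((starAssoc A A₁ A₂).hom ⊗ₘ (starAssoc B B₁ B₂).hom) =
      (starAssoc _ _ _).hom ≫ (𝟙 (A ⊗ B) ⋆ₘ ξ A₁ B₁ A₂ B₂) ≫ ξ A B (A₁ ⋆ A₂) (B₁ ⋆ B₂)
  starAssoc_μ : (μ ⋆ₘ 𝟙 (𝟙_ V)) ≫ μ = (starAssoc _ _ _).hom ≫ (𝟙 (𝟙_ V) ⋆ₘ μ) ≫ μ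
  starLeftUnitor_ξ (A B : V) :
    (γ ⋆ₘ 𝟙 (A ⊗ B)) ≫ ξ (starUnit V) (starUnit V) A B ≫
      ((starLeftUnitor A).hom ⊗ₘ (starLeftUnitor B).hom) = (starLeftUnitor (A ⊗ B)).hom
  starLeftUnitor_μ : (ν ⋆ₘ 𝟙 (𝟙_ V)) ≫ μ = (starLeftUnitor (𝟙_ V)).hom
  starRightUnitor_ξ (A B : V) :
    (𝟙 (A ⊗ B) ⋆ₘ γ) ≫ ξ A B (starUnit V) (starUnit V) ≫
      ((starRightUnitor A).hom ⊗ₘ (starRightUnitor B).hom) = (starRightUnitor (A ⊗ B)).hom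
  starRightUnitor_μ : (𝟙 (𝟙_ V) ⋆ₘ ν) ≫ μ = (starRightUnitor (𝟙_ V)).hom

/-- A duoidal category is normal when `ν : J ⟶ I` is invertible. -/
class Duoidal.IsNormal (V : Type u) [Category.{v} V] [MonoidalCategory V] [StarMonoidal V]
    [Duoidal V] : Prop where
  isIso_ν : IsIso (Duoidal.ν : starUnit V ⟶ 𝟙_ V)

attribute [instance] Duoidal.IsNormal.isIso_ν

noncomputable section

namespace Duoidal

section

variable {V : Type u} [Category.{v} V] [D : StarMonoidal V]

theorem starHom_comp {X Y Z X₁ Y₁ Z₁ : V} (f : X ⟶ Y) (g : Y ⟶ Z) (f₁ : X₁ ⟶ Y₁) (g₁ : Y₁ ⟶ Z₁) :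
    (f ⋆ₘ f₁) ≫ (g ⋆ₘ g₁) = (f ≫ g) ⋆ₘ (f₁ ≫ g₁) :=
  @tensorHom_comp_tensorHom V _ D.star _ _ _ _ _ _ f f₁ g g₁

theorem starHom_comp_assoc {X Y Z X₁ Y₁ Z₁ W : V} (f : X ⟶ Y) (g : Y ⟶ Z) (f₁ : X₁ ⟶ Y₁)
    (g₁ : Y₁ ⟶ Z₁) (h : Z ⋆ Z₁ ⟶ W) :
    (f ⋆ₘ f₁) ≫ (g ⋆ₘ g₁) ≫ h = ((f ≫ g) ⋆ₘ (f₁ ≫ g₁)) ≫ h := by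
  rw [← starHom_comp, Category.assoc]

theorem starHom_id (X Y : V) : (𝟙 X ⋆ₘ 𝟙 Y) = 𝟙 (X ⋆ Y) := @id_tensorHom_id V _ D.star X Y

theorem starLeftUnitor_natural {X Y : V} (f : X ⟶ Y) :
    (𝟙 (starUnit V) ⋆ₘ f) ≫ (starLeftUnitor Y).hom = (starLeftUnitor X).hom ≫ f := by
  have := @leftUnitor_naturality V _ D.star _ _ f
  rwa [← @id_tensorHom V _ D.star] at this

theorem starRightUnitor_natural {X Y : V} (f : X ⟶ Y) :
    (f ⋆ₘ 𝟙 (starUnit V)) ≫ (starRightUnitor Y).hom = (starRightUnitor X).hom ≫ f := by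
  have := @rightUnitor_naturality V _ D.star _ _ f
  rwa [← @tensorHom_id V _ D.star] at this

end

variable {V : Type u} [Category.{v} V] [MonoidalCategory V] [StarMonoidal V] [Duoidal V]

theorem ξ_natural_assoc {Y X Z W Y₁ X₁ Z₁ W₁ T : V} (f : Y ⟶ Y₁) (g : X ⟶ X₁) (h : Z ⟶ Z₁)
    (k : W ⟶ W₁) (t : (Y₁ ⋆ Z₁) ⊗ (X₁ ⋆ W₁) ⟶ T) :
    ((f ⊗ₘ g) ⋆ₘ (h ⊗ₘ k)) ≫ ξ Y₁ X₁ Z₁ W₁ ≫ t =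
      ξ Y X Z W ≫ ((f ⋆ₘ h) ⊗ₘ (g ⋆ₘ k)) ≫ t := by
  rw [← Category.assoc, ξ_natural, Category.assoc]

theorem ξ_left_comp {X X₀ Y Y₀ A B C A₁ B₁ C₁ T₁ T₂ T₃ : V} (a : X ⟶ X₀ ⊗ C)
    (b : Y ⟶ Y₀ ⊗ C₁) (c : X₀ ⟶ A ⊗ B) (d : Y₀ ⟶ A₁ ⊗ B₁)
    (f : A ⋆ A₁ ⟶ T₁) (g : B ⋆ B₁ ⟶ T₂) (h : C ⋆ C₁ ⟶ T₃) :
    (a ⋆ₘ b) ≫ ξ X₀ C Y₀ C₁ ≫ (((c ⋆ₘ d) ≫ ξ A B A₁ B₁ ≫ (f ⊗ₘ g)) ⊗ₘ h) ≫ (α_ _ _ _).hom =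
      ((a ≫ (c ⊗ₘ 𝟙 C) ≫ (α_ A B C).hom) ⋆ₘ (b ≫ (d ⊗ₘ 𝟙 C₁) ≫ (α_ A₁ B₁ C₁).hom)) ≫
        ξ A (B ⊗ C) A₁ (B₁ ⊗ C₁) ≫ (f ⊗ₘ (ξ B C B₁ C₁ ≫ (g ⊗ₘ h))) := by
  have e1 : (((c ⋆ₘ d) ≫ ξ A B A₁ B₁ ≫ (f ⊗ₘ g)) ⊗ₘ h) =
      ((c ⋆ₘ d) ⊗ₘ (𝟙 C ⋆ₘ 𝟙 C₁)) ≫ ξ A B A₁ B₁ ▷ (C ⋆ C₁) ≫ ((f ⊗ₘ g) ⊗ₘ h) := by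
    rw [← tensorHom_id, tensorHom_comp_tensorHom, tensorHom_comp_tensorHom, starHom_id,
      Category.id_comp, Category.id_comp]
  have e2 : (f ⊗ₘ (ξ B C B₁ C₁ ≫ (g ⊗ₘ h))) = (A ⋆ A₁) ◁ ξ B C B₁ C₁ ≫ (f ⊗ₘ (g ⊗ₘ h)) := by
    rw [← id_tensorHom, tensorHom_comp_tensorHom, Category.id_comp]
  have e3 := congrArg (· ≫ (f ⊗ₘ (g ⊗ₘ h))) (ξ_assoc A B C A₁ B₁ C₁)
  simp only [Category.assoc] at e3
  rw [e1, e2, Category.assoc, Category.assoc, ← ξ_natural_assoc,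
    MonoidalCategory.associator_naturality, ← e3, starHom_comp_assoc, starHom_comp_assoc,
    Category.assoc, Category.assoc]

theorem ξ_right_comp {X E Y E₁ A B C A₁ B₁ C₁ T₁ T₂ T₃ : V} (a : X ⟶ A ⊗ E)
    (b : Y ⟶ A₁ ⊗ E₁) (c : E ⟶ B ⊗ C) (d : E₁ ⟶ B₁ ⊗ C₁)
    (f : A ⋆ A₁ ⟶ T₁) (g : B ⋆ B₁ ⟶ T₂) (h : C ⋆ C₁ ⟶ T₃) :
    (a ⋆ₘ b) ≫ ξ A E A₁ E₁ ≫ (f ⊗ₘ ((c ⋆ₘ d) ≫ ξ B C B₁ C₁ ≫ (g ⊗ₘ h))) =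
      ((a ≫ (𝟙 A ⊗ₘ c)) ⋆ₘ (b ≫ (𝟙 A₁ ⊗ₘ d))) ≫
        ξ A (B ⊗ C) A₁ (B₁ ⊗ C₁) ≫ (f ⊗ₘ (ξ B C B₁ C₁ ≫ (g ⊗ₘ h))) := by
  have e1 : (f ⊗ₘ ((c ⋆ₘ d) ≫ ξ B C B₁ C₁ ≫ (g ⊗ₘ h))) =
      ((𝟙 A ⋆ₘ 𝟙 A₁) ⊗ₘ (c ⋆ₘ d)) ≫ (f ⊗ₘ (ξ B C B₁ C₁ ≫ (g ⊗ₘ h))) := by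
    rw [tensorHom_comp_tensorHom, starHom_id, Category.id_comp]
  rw [e1, ← ξ_natural_assoc, starHom_comp_assoc]

variable [IsNormal V]

/-- The unitor `I ⋆ X ⟶ X` in a normal duoidal category, where `I` is identified with `J`
along `ν`. -/
def lI (X : V) : 𝟙_ V ⋆ X ⟶ X := (inv (ν : starUnit V ⟶ 𝟙_ V) ⋆ₘ 𝟙 X) ≫ (starLeftUnitor X).hom

/-- The unitor `X ⋆ I ⟶ X` in a normal duoidal category, where `I` is identified with `J`
along `ν`. -/
def rI (X : V) : X ⋆ 𝟙_ V ⟶ X := (𝟙 X ⋆ₘ inv (ν : starUnit V ⟶ 𝟙_ V)) ≫ (starRightUnitor X).hom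

/-- The canonical morphism `σ : X ⋆ Y ⟶ X ⊗ Y`. -/
def σ (X Y : V) : X ⋆ Y ⟶ X ⊗ Y :=
  ((ρ_ X).inv ⋆ₘ (λ_ Y).inv) ≫ ξ X (𝟙_ V) (𝟙_ V) Y ≫ (rI X ⊗ₘ lI Y)

/-- The canonical morphism `τ : X ⋆ Y ⟶ Y ⊗ X`. -/
def τ (X Y : V) : X ⋆ Y ⟶ Y ⊗ X :=
  ((λ_ X).inv ⋆ₘ (ρ_ Y).inv) ≫ ξ (𝟙_ V) X Y (𝟙_ V) ≫ (lI Y ⊗ₘ rI X)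

theorem lI_natural {X Y : V} (f : X ⟶ Y) : (𝟙 (𝟙_ V) ⋆ₘ f) ≫ lI Y = lI X ≫ f := by
  rw [lI, lI, Category.assoc, ← starLeftUnitor_natural, starHom_comp_assoc, starHom_comp_assoc]
  simp

theorem rI_natural {X Y : V} (f : X ⟶ Y) : (f ⋆ₘ 𝟙 (𝟙_ V)) ≫ rI Y = rI X ≫ f := by
  rw [rI, rI, Category.assoc, ← starRightUnitor_natural, starHom_comp_assoc, starHom_comp_assoc]
  simp

theorem σ_natural {X Y Z W : V} (f : X ⟶ Z) (g : Y ⟶ W) :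
    (f ⋆ₘ g) ≫ σ Z W = σ X Y ≫ (f ⊗ₘ g) := by
  have e1 : f ≫ (ρ_ Z).inv = (ρ_ X).inv ≫ (f ⊗ₘ 𝟙 _) := by simp
  have e2 : g ≫ (λ_ W).inv = (λ_ Y).inv ≫ (𝟙 _ ⊗ₘ g) := by simp
  rw [σ, σ, starHom_comp_assoc, e1, e2, ← starHom_comp_assoc, ξ_natural_assoc,
    tensorHom_comp_tensorHom, lI_natural, rI_natural]
  simp

theorem τ_natural {X Y Z W : V} (f : X ⟶ Z) (g : Y ⟶ W) :
    (f ⋆ₘ g) ≫ τ Z W = τ X Y ≫ (g ⊗ₘ f) := by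
  have e1 : f ≫ (λ_ Z).inv = (λ_ X).inv ≫ (𝟙 _ ⊗ₘ f) := by simp
  have e2 : g ≫ (ρ_ W).inv = (ρ_ Y).inv ≫ (g ⊗ₘ 𝟙 _) := by simp
  rw [τ, τ, starHom_comp_assoc, e1, e2, ← starHom_comp_assoc, ξ_natural_assoc,
    tensorHom_comp_tensorHom, lI_natural, rI_natural]
  simp

theorem inv_ν_comul : inv (ν : starUnit V ⟶ 𝟙_ V) ≫ γ =
    (λ_ (𝟙_ V)).inv ≫ (inv (ν : starUnit V ⟶ 𝟙_ V) ⊗ₘ inv (ν : starUnit V ⟶ 𝟙_ V)) := by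
  have h : (γ : starUnit V ⟶ _) ≫ (ν ⊗ₘ ν) = ν ≫ (λ_ (𝟙_ V)).inv := by
    rw [MonoidalCategory.tensorHom_def, Iso.eq_comp_inv, Category.assoc, Category.assoc, leftUnitor_naturality,
      reassoc_of% (γ_counit_left (V := V))]
  rw [IsIso.inv_comp_eq, ← Category.assoc, ← h, Category.assoc, tensorHom_comp_tensorHom]
  simp

theorem lI_tensor (A B : V) : lI (A ⊗ B) =
    ((λ_ (𝟙_ V)).inv ⋆ₘ 𝟙 (A ⊗ B)) ≫ ξ (𝟙_ V) (𝟙_ V) A B ≫ (lI A ⊗ₘ lI B) := by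
  rw [lI, ← starLeftUnitor_ξ, starHom_comp_assoc, inv_ν_comul, ← starHom_comp_assoc,
    ← id_tensorHom_id, ξ_natural_assoc, tensorHom_comp_tensorHom]
  rfl

theorem rI_tensor (A B : V) : rI (A ⊗ B) =
    (𝟙 (A ⊗ B) ⋆ₘ (λ_ (𝟙_ V)).inv) ≫ ξ A B (𝟙_ V) (𝟙_ V) ≫ (rI A ⊗ₘ rI B) := by
  rw [rI, ← starRightUnitor_ξ, starHom_comp_assoc, inv_ν_comul, ← starHom_comp_assoc,
    ← id_tensorHom_id, ξ_natural_assoc, tensorHom_comp_tensorHom]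
  rfl

theorem lI_unit : lI (𝟙_ V) = μ := by
  rw [lI, ← starLeftUnitor_μ, starHom_comp_assoc]
  simp [starHom_id]

theorem rI_unit : rI (𝟙_ V) = μ := by
  rw [rI, ← starRightUnitor_μ, starHom_comp_assoc]
  simp [starHom_id]

/-- `X ⋆ (Y ⊗ Z) ⟶ (X ⋆ Y) ⊗ Z`. -/
def distR₁ (X Y Z : V) : X ⋆ (Y ⊗ Z) ⟶ (X ⋆ Y) ⊗ Z :=
  ((ρ_ X).inv ⋆ₘ 𝟙 (Y ⊗ Z)) ≫ ξ X (𝟙_ V) Y Z ≫ (𝟙 (X ⋆ Y) ⊗ₘ lI Z)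

/-- `X ⋆ (Y ⊗ Z) ⟶ Y ⊗ (X ⋆ Z)`. -/
def distR₂ (X Y Z : V) : X ⋆ (Y ⊗ Z) ⟶ Y ⊗ (X ⋆ Z) :=
  ((λ_ X).inv ⋆ₘ 𝟙 (Y ⊗ Z)) ≫ ξ (𝟙_ V) X Y Z ≫ (lI Y ⊗ₘ 𝟙 (X ⋆ Z))

/-- `(Y ⊗ Z) ⋆ X ⟶ Y ⊗ (Z ⋆ X)`. -/
def distL₁ (X Y Z : V) : (Y ⊗ Z) ⋆ X ⟶ Y ⊗ (Z ⋆ X) :=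
  (𝟙 (Y ⊗ Z) ⋆ₘ (λ_ X).inv) ≫ ξ Y Z (𝟙_ V) X ≫ (rI Y ⊗ₘ 𝟙 (Z ⋆ X))

/-- `(Y ⊗ Z) ⋆ X ⟶ (Y ⋆ X) ⊗ Z`. -/
def distL₂ (X Y Z : V) : (Y ⊗ Z) ⋆ X ⟶ (Y ⋆ X) ⊗ Z :=
  (𝟙 (Y ⊗ Z) ⋆ₘ (ρ_ X).inv) ≫ ξ Y Z X (𝟙_ V) ≫ (𝟙 (Y ⋆ X) ⊗ₘ rI Z)

theorem σ_tensor_right (X Y Z : V) :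
    σ X (Y ⊗ Z) = distR₁ X Y Z ≫ (σ X Y ⊗ₘ 𝟙 Z) ≫ (α_ X Y Z).hom := by
  rw [distR₁, Category.assoc, Category.assoc, tensorHom_comp_tensorHom_assoc, Category.id_comp,
    Category.comp_id, σ, σ, lI_tensor, ξ_left_comp, ξ_right_comp]
  congr 2 <;> monoidal

theorem distR₁_τ (X Y Z : V) :
    distR₁ X Y Z ≫ (τ X Y ⊗ₘ 𝟙 Z) ≫ (α_ Y X Z).hom = distR₂ X Y Z ≫ (𝟙 Y ⊗ₘ σ X Z) := by
  rw [distR₁, distR₂, Category.assoc, Category.assoc, Category.assoc, Category.assoc,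
    tensorHom_comp_tensorHom_assoc, tensorHom_comp_tensorHom, Category.id_comp,
    Category.comp_id, Category.id_comp, Category.comp_id, σ, τ, ξ_left_comp, ξ_right_comp]
  congr 2 <;> monoidal

theorem τ_tensor_right (X Y Z : V) :
    τ X (Y ⊗ Z) ≫ (α_ Y Z X).hom = distR₂ X Y Z ≫ (𝟙 Y ⊗ₘ τ X Z) := by
  rw [distR₂, Category.assoc, Category.assoc, tensorHom_comp_tensorHom, Category.id_comp,
    Category.comp_id, τ, τ, Category.assoc, Category.assoc, lI_tensor, ξ_left_comp, ξ_right_comp]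
  congr 2 <;> monoidal

theorem σ_tensor_left (X Y Z : V) :
    σ (Y ⊗ Z) X ≫ (α_ Y Z X).hom = distL₁ X Y Z ≫ (𝟙 Y ⊗ₘ σ Z X) := by
  rw [distL₁, Category.assoc, Category.assoc, tensorHom_comp_tensorHom, Category.id_comp,
    Category.comp_id, σ, σ, Category.assoc, Category.assoc, rI_tensor, ξ_left_comp, ξ_right_comp]
  congr 2 <;> monoidal

theorem distL₁_τ (X Y Z : V) :
    distL₁ X Y Z ≫ (𝟙 Y ⊗ₘ τ Z X) = distL₂ X Y Z ≫ (σ Y X ⊗ₘ 𝟙 Z) ≫ (α_ Y X Z).hom := by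
  rw [distL₁, distL₂, Category.assoc, Category.assoc, Category.assoc, Category.assoc,
    tensorHom_comp_tensorHom_assoc, tensorHom_comp_tensorHom, Category.id_comp,
    Category.comp_id, Category.id_comp, Category.comp_id, σ, τ, ξ_left_comp, ξ_right_comp]
  congr 2 <;> monoidal

theorem τ_tensor_left (X Y Z : V) :
    τ (Y ⊗ Z) X = distL₂ X Y Z ≫ (τ Y X ⊗ₘ 𝟙 Z) ≫ (α_ X Y Z).hom := by
  rw [distL₂, Category.assoc, Category.assoc, tensorHom_comp_tensorHom_assoc, Category.id_comp,
    Category.comp_id, τ, τ, rI_tensor, ξ_left_comp, ξ_right_comp]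
  congr 2 <;> monoidal

theorem σ_unit_right (X : V) : σ X (𝟙_ V) ≫ (ρ_ X).hom = rI X := by
  have h := ξ_rightUnit X (𝟙_ V)
  rw [σ, Category.assoc, Category.assoc, lI_unit, MonoidalCategory.tensorHom_def', Category.assoc,
    rightUnitor_naturality, reassoc_of% h, starHom_comp_assoc, ← unitors_equal]
  simp [starHom_id]

theorem τ_unit_right (X : V) : τ X (𝟙_ V) ≫ (λ_ X).hom = rI X := by
  have h := ξ_leftUnit X (𝟙_ V)
  rw [τ, Category.assoc, Category.assoc, lI_unit, MonoidalCategory.tensorHom_def, Category.assoc,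
    leftUnitor_naturality, reassoc_of% h, starHom_comp_assoc, unitors_equal]
  simp [starHom_id]

theorem σ_unit_left (X : V) : σ (𝟙_ V) X ≫ (λ_ X).hom = lI X := by
  have h := ξ_leftUnit (𝟙_ V) X
  rw [σ, Category.assoc, Category.assoc, rI_unit, MonoidalCategory.tensorHom_def, Category.assoc,
    leftUnitor_naturality, reassoc_of% h, starHom_comp_assoc, unitors_equal]
  simp [starHom_id]

theorem τ_unit_left (X : V) : τ (𝟙_ V) X ≫ (ρ_ X).hom = lI X := by
  have h := ξ_rightUnit (𝟙_ V) X
  rw [τ, Category.assoc, Category.assoc, rI_unit, MonoidalCategory.tensorHom_def', Category.assoc,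
    rightUnitor_naturality, reassoc_of% h, starHom_comp_assoc, ← unitors_equal]
  simp [starHom_id]

end Duoidal

/-! ### Graded categories -/

section Graded

variable (V : Type u) [Category.{v} V] [MonoidalCategory V]

/-- A (left) `V`-graded category. Here `Hom X A B` is the set of graded morphisms from `A` to `B`
with grade `X`, and `reindex α f` is the reindexing `α^* f`. -/
structure GradedCat where
  Obj : Type w
  Hom : V → Obj → Obj → Type x
  reindex {X Y : V} {A B : Obj} (α : Y ⟶ X) (f : Hom X A B) : Hom Y A B
  /-- The composite `g ∘ f`, with grade `Y ⊗ X`. -/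
  comp {X Y : V} {A B C : Obj} (g : Hom Y B C) (f : Hom X A B) : Hom (Y ⊗ X) A C
  id (A : Obj) : Hom (𝟙_ V) A A
  reindex_id {X : V} {A B : Obj} (f : Hom X A B) : reindex (𝟙 X) f = f
  reindex_reindex {X Y Z : V} {A B : Obj} (α : Z ⟶ Y) (β : Y ⟶ X) (f : Hom X A B) :
    reindex α (reindex β f) = reindex (α ≫ β) f
  comp_reindex {X X₁ Y Y₁ : V} {A B C : Obj} (β : Y₁ ⟶ Y) (α : X₁ ⟶ X) (g : Hom Y B C)
    (f : Hom X A B) : comp (reindex β g) (reindex α f) = reindex (β ⊗ₘ α) (comp g f)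
  assoc {X Y Z : V} {A B C D : Obj} (h : Hom Z C D) (g : Hom Y B C) (f : Hom X A B) :
    comp (comp h g) f = reindex (α_ Z Y X).hom (comp h (comp g f))
  comp_id {X : V} {A B : Obj} (f : Hom X A B) : comp f (id A) = reindex (ρ_ X).hom f
  id_comp {X : V} {A B : Obj} (f : Hom X A B) : comp (id B) f = reindex (λ_ X).hom f

variable {V}

/-- A (left) `V`-graded functor. -/
structure GradedFunctor (A : GradedCat.{u, v, w, x} V) (C : GradedCat V) where
  obj : A.Obj → C.Obj
  map {X : V} {a b : A.Obj} (f : A.Hom X a b) : C.Hom X (obj a) (obj b)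
  map_reindex {X Y : V} {a b : A.Obj} (α : Y ⟶ X) (f : A.Hom X a b) :
    map (A.reindex α f) = C.reindex α (map f)
  map_comp {X Y : V} {a b c : A.Obj} (g : A.Hom Y b c) (f : A.Hom X a b) :
    map (A.comp g f) = C.comp (map g) (map f)
  map_id (a : A.Obj) : map (A.id a) = C.id (obj a)

/-- An isomorphism of `V`-graded categories: a `V`-graded functor that is bijective on objects and
on graded morphisms. -/
structure GradedIso (A C : GradedCat V) extends GradedFunctor A C where
  obj_bijective : Function.Bijective obj
  map_bijective (X : V) (a b : A.Obj) :
    Function.Bijective (fun f : A.Hom X a b => map f)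

namespace GradedCat

variable {C : GradedCat V}

theorem comp_reindex_left {X Y Y₁ : V} {a b c : C.Obj} (β : Y₁ ⟶ Y) (g : C.Hom Y b c)
    (f : C.Hom X a b) : C.comp (C.reindex β g) f = C.reindex (β ⊗ₘ 𝟙 X) (C.comp g f) := by
  rw [← C.comp_reindex, C.reindex_id]

theorem comp_reindex_right {X X₁ Y : V} {a b c : C.Obj} (α : X₁ ⟶ X) (g : C.Hom Y b c)
    (f : C.Hom X a b) : C.comp g (C.reindex α f) = C.reindex (𝟙 Y ⊗ₘ α) (C.comp g f) := by
  rw [← C.comp_reindex, C.reindex_id]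

end GradedCat

variable [StarMonoidal V] [Duoidal V] [Duoidal.IsNormal V]

open Duoidal

/-- `(f, g, φ, ψ)` is a `V`-graded square: `σ^* (g ∘ φ) = τ^* (ψ ∘ f)`. -/
def GradedCat.IsSquare (C : GradedCat V) {X Y : V} {a a₁ b b₁ : C.Obj} (f : C.Hom X a a₁)
    (g : C.Hom X b b₁) (φ : C.Hom Y a b) (ψ : C.Hom Y a₁ b₁) : Prop :=
  C.reindex (σ X Y) (C.comp g φ) = C.reindex (τ X Y) (C.comp ψ f)

namespace GradedCat

variable {C : GradedCat V}

namespace IsSquare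

theorem reindex {X Y X₁ Y₁ : V} {a a₁ b b₁ : C.Obj} {f : C.Hom X a a₁} {g : C.Hom X b b₁}
    {φ : C.Hom Y a b} {ψ : C.Hom Y a₁ b₁} (h : C.IsSquare f g φ ψ) (α : X₁ ⟶ X) (β : Y₁ ⟶ Y) :
    C.IsSquare (C.reindex α f) (C.reindex α g) (C.reindex β φ) (C.reindex β ψ) := by
  unfold IsSquare at *
  rw [C.comp_reindex, C.comp_reindex, C.reindex_reindex, C.reindex_reindex, ← σ_natural,
    ← τ_natural, ← C.reindex_reindex, h, C.reindex_reindex]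

theorem id_right {X : V} {a b : C.Obj} (f : C.Hom X a b) :
    C.IsSquare f f (C.id a) (C.id b) := by
  unfold IsSquare
  rw [C.comp_id, C.id_comp, C.reindex_reindex, C.reindex_reindex, σ_unit_right, τ_unit_right]

theorem id_left {X : V} {a b : C.Obj} (f : C.Hom X a b) :
    C.IsSquare (C.id a) (C.id b) f f := by
  unfold IsSquare
  rw [C.comp_id, C.id_comp, C.reindex_reindex, C.reindex_reindex, σ_unit_left, τ_unit_left]

theorem comp_right {X Y Z : V} {a a₁ b b₁ c c₁ : C.Obj} {f : C.Hom X a a₁} {g : C.Hom X b b₁}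
    {h : C.Hom X c c₁} {φ : C.Hom Z a b} {φ₁ : C.Hom Z a₁ b₁} {ψ : C.Hom Y b c}
    {ψ₁ : C.Hom Y b₁ c₁} (s : C.IsSquare f g φ φ₁) (t : C.IsSquare g h ψ ψ₁) :
    C.IsSquare f h (C.comp ψ φ) (C.comp ψ₁ φ₁) := by
  unfold IsSquare at *
  rw [σ_tensor_right, ← C.reindex_reindex, ← C.reindex_reindex, ← C.assoc,
    ← comp_reindex_left, t, comp_reindex_left, C.assoc, C.reindex_reindex, C.reindex_reindex,
    Category.assoc, distR₁_τ, ← C.reindex_reindex, ← comp_reindex_right, s, comp_reindex_right,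
    C.reindex_reindex, ← τ_tensor_right, C.assoc, C.reindex_reindex]

theorem comp_left {X Y Z : V} {a a₁ b b₁ c c₁ : C.Obj} {f : C.Hom X a a₁} {g : C.Hom X b b₁}
    {h : C.Hom X c c₁} {φ : C.Hom Z a b} {φ₁ : C.Hom Z a₁ b₁} {ψ : C.Hom Y b c}
    {ψ₁ : C.Hom Y b₁ c₁} (s : C.IsSquare φ φ₁ f g) (t : C.IsSquare ψ ψ₁ g h) :
    C.IsSquare (C.comp ψ φ) (C.comp ψ₁ φ₁) f h := by
  unfold IsSquare at *
  rw [C.assoc ψ₁ φ₁ f, C.reindex_reindex, σ_tensor_left, ← C.reindex_reindex,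
    ← comp_reindex_right, s, comp_reindex_right, C.reindex_reindex, distL₁_τ,
    ← C.reindex_reindex, ← C.reindex_reindex, ← C.assoc, ← comp_reindex_left, t,
    comp_reindex_left, C.assoc, C.reindex_reindex, C.reindex_reindex, τ_tensor_left,
    Category.assoc]

end IsSquare

variable (A : GradedCat.{u, v, w, x} V) (C : GradedCat.{u, v, y, x} V)

/-- The `V`-graded functor category `[A, C]_r`: its objects are the `V`-graded functors `A ⟶ C`,
and a graded morphism `F ⟶ G` of grade `Y` is a family of graded morphisms
`φ a : F a ⟶ G a` of grade `Y` such that `(F f, G f, φ a, φ b)` is a `V`-graded square for every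
graded morphism `f : a ⟶ b` of `A`. -/
def funR : GradedCat V where
  Obj := GradedFunctor A C
  Hom Y F G := { φ : ∀ a, C.Hom Y (F.obj a) (G.obj a) //
    ∀ (X : V) (a b : A.Obj) (f : A.Hom X a b), C.IsSquare (F.map f) (G.map f) (φ a) (φ b) }
  reindex α φ := ⟨fun a => C.reindex α (φ.1 a), fun X a b f => by
    simpa only [C.reindex_id] using (φ.2 X a b f).reindex (𝟙 X) α⟩
  comp ψ φ := ⟨fun a => C.comp (ψ.1 a) (φ.1 a), fun X a b f =>
    (φ.2 X a b f).comp_right (ψ.2 X a b f)⟩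
  id F := ⟨fun a => C.id (F.obj a), fun X a b f => IsSquare.id_right (F.map f)⟩
  reindex_id φ := Subtype.ext (funext fun a => C.reindex_id _)
  reindex_reindex α β φ := Subtype.ext (funext fun a => C.reindex_reindex _ _ _)
  comp_reindex β α ψ φ := Subtype.ext (funext fun a => C.comp_reindex _ _ _ _)
  assoc χ ψ φ := Subtype.ext (funext fun a => C.assoc _ _ _)
  comp_id φ := Subtype.ext (funext fun a => C.comp_id _)
  id_comp φ := Subtype.ext (funext fun a => C.id_comp _)

/-- The `V`-graded functor category `[A, C]_ℓ`: its objects are the `V`-graded functors `A ⟶ C`,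
and a graded morphism `F ⟶ G` of grade `X` is a family of graded morphisms
`φ a : F a ⟶ G a` of grade `X` such that `(φ a, φ b, F f, G f)` is a `V`-graded square for every
graded morphism `f : a ⟶ b` of `A`. -/
def funL : GradedCat V where
  Obj := GradedFunctor A C
  Hom X F G := { φ : ∀ a, C.Hom X (F.obj a) (G.obj a) //
    ∀ (Y : V) (a b : A.Obj) (f : A.Hom Y a b), C.IsSquare (φ a) (φ b) (F.map f) (G.map f) }
  reindex α φ := ⟨fun a => C.reindex α (φ.1 a), fun X a b f => by
    simpa only [C.reindex_id] using (φ.2 X a b f).reindex α (𝟙 X)⟩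
  comp ψ φ := ⟨fun a => C.comp (ψ.1 a) (φ.1 a), fun X a b f =>
    (φ.2 X a b f).comp_left (ψ.2 X a b f)⟩
  id F := ⟨fun a => C.id (F.obj a), fun X a b f => IsSquare.id_left (F.map f)⟩
  reindex_id φ := Subtype.ext (funext fun a => C.reindex_id _)
  reindex_reindex α β φ := Subtype.ext (funext fun a => C.reindex_reindex _ _ _)
  comp_reindex β α ψ φ := Subtype.ext (funext fun a => C.comp_reindex _ _ _ _)
  assoc χ ψ φ := Subtype.ext (funext fun a => C.assoc _ _ _)
  comp_id φ := Subtype.ext (funext fun a => C.comp_id _)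
  id_comp φ := Subtype.ext (funext fun a => C.id_comp _)

end GradedCat

end Graded

/-! ### Enriched categories and the enriched functor categories of Garner and López Franco -/

section Biclosed

variable {V : Type u} [Category.{v} V]

variable (V) in
/-- `V` is `⋆`-biclosed: all functors `X ⋆ -` and `- ⋆ X` have right adjoints. -/
class StarBiclosed [StarMonoidal V] : Prop where
  left (X : V) : (@tensorLeft V _ StarMonoidal.star X).IsLeftAdjoint
  right (X : V) : (@tensorRight V _ StarMonoidal.star X).IsLeftAdjoint

variable [StarMonoidal V]

/-- The functor `X ⋆ -`. -/
abbrev starL (X : V) : V ⥤ V := @tensorLeft V _ StarMonoidal.star X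

/-- The functor `- ⋆ X`. -/
abbrev starR (X : V) : V ⥤ V := @tensorRight V _ StarMonoidal.star X

variable [StarBiclosed V]

instance (X : V) : (starL X).IsLeftAdjoint := StarBiclosed.left X

instance (X : V) : (starR X).IsLeftAdjoint := StarBiclosed.right X

/-- `[X, Y]_r`, where `[X, -]_r` is right adjoint to `X ⋆ -`. -/
def ihomR (X Y : V) : V := (starL X).rightAdjoint.obj Y

/-- `[X, Y]_ℓ`, where `[X, -]_ℓ` is right adjoint to `- ⋆ X`. -/
def ihomL (X Y : V) : V := (starR X).rightAdjoint.obj Y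

/-- Transposition of morphisms `X ⋆ Z ⟶ Y`. -/
def curryR (X : V) {Z Y : V} (f : X ⋆ Z ⟶ Y) : Z ⟶ ihomR X Y :=
  (Adjunction.ofIsLeftAdjoint (starL X)).homEquiv Z Y f

/-- Transposition of morphisms `Z ⋆ X ⟶ Y`. -/
def curryL (X : V) {Z Y : V} (f : Z ⋆ X ⟶ Y) : Z ⟶ ihomL X Y :=
  (Adjunction.ofIsLeftAdjoint (starR X)).homEquiv Z Y f

theorem curryR_injective {X Z Y : V} {f g : X ⋆ Z ⟶ Y} (h : curryR X f = curryR X g) : f = g :=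
  (Equiv.injective _) h

theorem curryL_injective {X Z Y : V} {f g : Z ⋆ X ⟶ Y} (h : curryL X f = curryL X g) : f = g :=
  (Equiv.injective _) h

theorem comp_curryR {X Z Z₁ Y : V} (h : Z₁ ⟶ Z) (f : X ⋆ Z ⟶ Y) :
    h ≫ curryR X f = curryR X ((𝟙 X ⋆ₘ h) ≫ f) := by
  have := (Adjunction.ofIsLeftAdjoint (starL X)).homEquiv_naturality_left h f
  rw [show (𝟙 X ⋆ₘ h) = (starL X).map h from @id_tensorHom V _ StarMonoidal.star X _ _ h]
  exact this.symm

theorem comp_curryL {X Z Z₁ Y : V} (h : Z₁ ⟶ Z) (f : Z ⋆ X ⟶ Y) :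
    h ≫ curryL X f = curryL X ((h ⋆ₘ 𝟙 X) ≫ f) := by
  have := (Adjunction.ofIsLeftAdjoint (starR X)).homEquiv_naturality_left h f
  rw [show (h ⋆ₘ 𝟙 X) = (starR X).map h from @tensorHom_id V _ StarMonoidal.star _ _ h X]
  exact this.symm

end Biclosed

section Enriched

variable (V : Type u) [Category.{v} V] [MonoidalCategory V]

/-- A (left) `V`-category, in the convention of Eilenberg and Kelly: composition is a morphism
`Hom B C ⊗ Hom A B ⟶ Hom A C`. (The class `EnrichedCategory` uses the opposite order, which matters
since `V` has no symmetry.) -/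
structure VCat where
  Obj : Type w
  Hom : Obj → Obj → V
  id (A : Obj) : 𝟙_ V ⟶ Hom A A
  comp (A B C : Obj) : Hom B C ⊗ Hom A B ⟶ Hom A C
  id_comp (A B : Obj) : id B ▷ Hom A B ≫ comp A B B = (λ_ (Hom A B)).hom
  comp_id (A B : Obj) : Hom A B ◁ id A ≫ comp A A B = (ρ_ (Hom A B)).hom
  assoc (A B C D : Obj) : comp B C D ▷ Hom A B ≫ comp A B D =
    (α_ (Hom C D) (Hom B C) (Hom A B)).hom ≫ Hom C D ◁ comp A B C ≫ comp A C D

variable {V}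

/-- A (left) `V`-functor. -/
structure VFunctor (A C : VCat V) where
  obj : A.Obj → C.Obj
  map (a b : A.Obj) : A.Hom a b ⟶ C.Hom (obj a) (obj b)
  map_id (a : A.Obj) : A.id a ≫ map a a = C.id (obj a)
  map_comp (a b c : A.Obj) : A.comp a b c ≫ map a c =
    (map b c ⊗ₘ map a b) ≫ C.comp (obj a) (obj b) (obj c)

/-- A `V`-category regarded as a `V`-graded category: a graded morphism `A ⟶ B` of grade `X` is a
morphism `X ⟶ C(A, B)` in `V`. -/
def VCat.toGraded (C : VCat V) : GradedCat V where
  Obj := C.Obj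
  Hom X A B := X ⟶ C.Hom A B
  reindex α f := α ≫ f
  comp {X Y A B D} g f := (g ⊗ₘ f) ≫ C.comp A B D
  id A := C.id A
  reindex_id f := Category.id_comp f
  reindex_reindex α β f := (Category.assoc α β f).symm
  comp_reindex β α g f := by rw [← tensorHom_comp_tensorHom, Category.assoc]
  assoc {X Y Z A B C₁ D} h g f := by
    have e1 : ((h ⊗ₘ g) ≫ C.comp B C₁ D ⊗ₘ f) = ((h ⊗ₘ g) ⊗ₘ f) ≫ C.comp B C₁ D ▷ _ := by
      rw [← tensorHom_id, tensorHom_comp_tensorHom, Category.comp_id]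
    have e2 : (h ⊗ₘ (g ⊗ₘ f) ≫ C.comp A B C₁) = (h ⊗ₘ (g ⊗ₘ f)) ≫ _ ◁ C.comp A B C₁ := by
      rw [← id_tensorHom, tensorHom_comp_tensorHom, Category.comp_id]
    rw [e1, e2, Category.assoc, Category.assoc, C.assoc,
      MonoidalCategory.associator_naturality_assoc]
  comp_id f := by
    rw [MonoidalCategory.tensorHom_def, Category.assoc, C.comp_id, rightUnitor_naturality]
  id_comp f := by
    rw [MonoidalCategory.tensorHom_def', Category.assoc, C.id_comp, leftUnitor_naturality]

namespace GLF

open Duoidal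

variable [StarMonoidal V] [Duoidal V] [IsNormal V] [StarBiclosed V]

section

variable {A : VCat.{u, v, w} V} {C : VCat.{u, v, y} V} (F G : VFunctor A C)

/-- The diagram, in `V`,
`C(F a, G a) ⟶ [A(a, b), C(F a, G b)]_r ⟵ C(F b, G b)` (`a, b` objects of `A`),
whose legs are the transposes of
`A(a, b) ⋆ C(F a, G a) --σ--> A(a, b) ⊗ C(F a, G a) ⟶ C(G a, G b) ⊗ C(F a, G a) ⟶ C(F a, G b)` and
`A(a, b) ⋆ C(F b, G b) --τ--> C(F b, G b) ⊗ A(a, b) ⟶ C(F b, G b) ⊗ C(F a, F b) ⟶ C(F a, G b)`. -/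
def diagramR : MulticospanIndex
    { L := A.Obj, R := A.Obj × A.Obj, fst := Prod.fst, snd := Prod.snd } V where
  left a := C.Hom (F.obj a) (G.obj a)
  right p := ihomR (A.Hom p.1 p.2) (C.Hom (F.obj p.1) (G.obj p.2))
  fst p := curryR (A.Hom p.1 p.2)
    (σ _ _ ≫ (G.map p.1 p.2 ⊗ₘ 𝟙 _) ≫ C.comp (F.obj p.1) (G.obj p.1) (G.obj p.2))
  snd p := curryR (A.Hom p.1 p.2)
    (τ _ _ ≫ (𝟙 _ ⊗ₘ F.map p.1 p.2) ≫ C.comp (F.obj p.1) (F.obj p.2) (G.obj p.2))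

/-- The diagram, in `V`,
`C(F a, G a) ⟶ [A(a, b), C(F a, G b)]_ℓ ⟵ C(F b, G b)` (`a, b` objects of `A`),
whose legs are the transposes of
`C(F a, G a) ⋆ A(a, b) --τ--> A(a, b) ⊗ C(F a, G a) ⟶ C(G a, G b) ⊗ C(F a, G a) ⟶ C(F a, G b)` and
`C(F b, G b) ⋆ A(a, b) --σ--> C(F b, G b) ⊗ A(a, b) ⟶ C(F b, G b) ⊗ C(F a, F b) ⟶ C(F a, G b)`. -/
def diagramL : MulticospanIndex
    { L := A.Obj, R := A.Obj × A.Obj, fst := Prod.fst, snd := Prod.snd } V where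
  left a := C.Hom (F.obj a) (G.obj a)
  right p := ihomL (A.Hom p.1 p.2) (C.Hom (F.obj p.1) (G.obj p.2))
  fst p := curryL (A.Hom p.1 p.2)
    (τ _ _ ≫ (G.map p.1 p.2 ⊗ₘ 𝟙 _) ≫ C.comp (F.obj p.1) (G.obj p.1) (G.obj p.2))
  snd p := curryL (A.Hom p.1 p.2)
    (σ _ _ ≫ (𝟙 _ ⊗ₘ F.map p.1 p.2) ≫ C.comp (F.obj p.1) (F.obj p.2) (G.obj p.2))

variable {F G}

theorem diagramR_condition {X : V} (φ : ∀ a, X ⟶ C.Hom (F.obj a) (G.obj a)) (a b : A.Obj) :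
    φ a ≫ (diagramR F G).fst (a, b) = φ b ≫ (diagramR F G).snd (a, b) ↔
      C.toGraded.IsSquare (F.map a b) (G.map a b) (φ a) (φ b) := by
  have e1 : φ a ≫ (diagramR F G).fst (a, b) =
      curryR (A.Hom a b) (σ _ _ ≫ (G.map a b ⊗ₘ φ a) ≫ C.comp _ _ _) := by
    simp only [diagramR]
    rw [comp_curryR, reassoc_of% (σ_natural (𝟙 (A.Hom a b)) (φ a)),
      tensorHom_comp_tensorHom_assoc, Category.id_comp, Category.comp_id]
  have e2 : φ b ≫ (diagramR F G).snd (a, b) =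
      curryR (A.Hom a b) (τ _ _ ≫ (φ b ⊗ₘ F.map a b) ≫ C.comp _ _ _) := by
    simp only [diagramR]
    rw [comp_curryR, reassoc_of% (τ_natural (𝟙 (A.Hom a b)) (φ b)),
      tensorHom_comp_tensorHom_assoc, Category.id_comp, Category.comp_id]
  rw [e1, e2]
  exact ⟨fun h => curryR_injective h, fun h => congrArg (curryR _) h⟩

theorem diagramL_condition {X : V} (φ : ∀ a, X ⟶ C.Hom (F.obj a) (G.obj a)) (a b : A.Obj) :
    φ a ≫ (diagramL F G).fst (a, b) = φ b ≫ (diagramL F G).snd (a, b) ↔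
      C.toGraded.IsSquare (φ a) (φ b) (F.map a b) (G.map a b) := by
  have e1 : φ a ≫ (diagramL F G).fst (a, b) =
      curryL (A.Hom a b) (τ _ _ ≫ (G.map a b ⊗ₘ φ a) ≫ C.comp _ _ _) := by
    simp only [diagramL]
    rw [comp_curryL, reassoc_of% (τ_natural (φ a) (𝟙 (A.Hom a b))),
      tensorHom_comp_tensorHom_assoc, Category.id_comp, Category.comp_id]
  have e2 : φ b ≫ (diagramL F G).snd (a, b) =
      curryL (A.Hom a b) (σ _ _ ≫ (φ b ⊗ₘ F.map a b) ≫ C.comp _ _ _) := by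
    simp only [diagramL]
    rw [comp_curryL, reassoc_of% (σ_natural (φ b) (𝟙 (A.Hom a b))),
      tensorHom_comp_tensorHom_assoc, Category.id_comp, Category.comp_id]
  rw [e1, e2]
  exact ⟨fun h => (curryL_injective h).symm, fun h => congrArg (curryL _) h.symm⟩

end

variable [HasLimitsOfSize.{w, w} V] {A : VCat.{u, v, w} V} {C : VCat.{u, v, y} V}

/-- The hom-object `[A, C]_r(F, G)`. -/
def homR (F G : VFunctor A C) : V := multiequalizer (diagramR F G)

/-- The hom-object `[A, C]_ℓ(F, G)`. -/
def homL (F G : VFunctor A C) : V := multiequalizer (diagramL F G)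

def projR (F G : VFunctor A C) (a : A.Obj) : homR F G ⟶ C.Hom (F.obj a) (G.obj a) :=
  Multiequalizer.ι (diagramR F G) a

def projL (F G : VFunctor A C) (a : A.Obj) : homL F G ⟶ C.Hom (F.obj a) (G.obj a) :=
  Multiequalizer.ι (diagramL F G) a

theorem projR_isSquare (F G : VFunctor A C) (a b : A.Obj) :
    C.toGraded.IsSquare (F.map a b) (G.map a b) (projR F G a) (projR F G b) :=
  (diagramR_condition _ a b).1 (Multiequalizer.condition (diagramR F G) (a, b))

theorem projL_isSquare (F G : VFunctor A C) (a b : A.Obj) :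
    C.toGraded.IsSquare (projL F G a) (projL F G b) (F.map a b) (G.map a b) :=
  (diagramL_condition _ a b).1 (Multiequalizer.condition (diagramL F G) (a, b))

def liftR {F G : VFunctor A C} {X : V} (φ : ∀ a, X ⟶ C.Hom (F.obj a) (G.obj a))
    (h : ∀ a b, C.toGraded.IsSquare (F.map a b) (G.map a b) (φ a) (φ b)) : X ⟶ homR F G :=
  Multiequalizer.lift (diagramR F G) X φ (fun p => (diagramR_condition φ p.1 p.2).2 (h p.1 p.2))

def liftL {F G : VFunctor A C} {X : V} (φ : ∀ a, X ⟶ C.Hom (F.obj a) (G.obj a))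
    (h : ∀ a b, C.toGraded.IsSquare (φ a) (φ b) (F.map a b) (G.map a b)) : X ⟶ homL F G :=
  Multiequalizer.lift (diagramL F G) X φ (fun p => (diagramL_condition φ p.1 p.2).2 (h p.1 p.2))

theorem liftR_proj {F G : VFunctor A C} {X : V} (φ : ∀ a, X ⟶ C.Hom (F.obj a) (G.obj a))
    (h : ∀ a b, C.toGraded.IsSquare (F.map a b) (G.map a b) (φ a) (φ b)) (a : A.Obj) :
    liftR φ h ≫ projR F G a = φ a :=
  Multiequalizer.lift_ι _ _ _ _ _

theorem liftL_proj {F G : VFunctor A C} {X : V} (φ : ∀ a, X ⟶ C.Hom (F.obj a) (G.obj a))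
    (h : ∀ a b, C.toGraded.IsSquare (φ a) (φ b) (F.map a b) (G.map a b)) (a : A.Obj) :
    liftL φ h ≫ projL F G a = φ a :=
  Multiequalizer.lift_ι _ _ _ _ _

theorem homR_ext {F G : VFunctor A C} {X : V} {f g : X ⟶ homR F G}
    (h : ∀ a, f ≫ projR F G a = g ≫ projR F G a) : f = g :=
  Multiequalizer.hom_ext _ _ _ h

theorem homL_ext {F G : VFunctor A C} {X : V} {f g : X ⟶ homL F G}
    (h : ∀ a, f ≫ projL F G a = g ≫ projL F G a) : f = g :=
  Multiequalizer.hom_ext _ _ _ h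

theorem compR_isSquare (F G H : VFunctor A C) (a b : A.Obj) :
    C.toGraded.IsSquare (F.map a b) (H.map a b)
      ((projR G H a ⊗ₘ projR F G a) ≫ C.comp _ _ _)
      ((projR G H b ⊗ₘ projR F G b) ≫ C.comp _ _ _) :=
  (projR_isSquare F G a b).comp_right (projR_isSquare G H a b)

theorem compL_isSquare (F G H : VFunctor A C) (a b : A.Obj) :
    C.toGraded.IsSquare ((projL G H a ⊗ₘ projL F G a) ≫ C.comp _ _ _)
      ((projL G H b ⊗ₘ projL F G b) ≫ C.comp _ _ _) (F.map a b) (H.map a b) :=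
  (projL_isSquare F G a b).comp_left (projL_isSquare G H a b)

/-- Composition in `[A, C]_r`, induced by composition in `C`. -/
def compR (F G H : VFunctor A C) : homR G H ⊗ homR F G ⟶ homR F H :=
  liftR (fun a => (projR G H a ⊗ₘ projR F G a) ≫ C.comp _ _ _) (compR_isSquare F G H)

/-- Composition in `[A, C]_ℓ`, induced by composition in `C`. -/
def compL (F G H : VFunctor A C) : homL G H ⊗ homL F G ⟶ homL F H :=
  liftL (fun a => (projL G H a ⊗ₘ projL F G a) ≫ C.comp _ _ _) (compL_isSquare F G H)

theorem compR_proj (F G H : VFunctor A C) (a : A.Obj) :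
    compR F G H ≫ projR F H a = (projR G H a ⊗ₘ projR F G a) ≫ C.comp _ _ _ :=
  liftR_proj _ _ a

theorem compL_proj (F G H : VFunctor A C) (a : A.Obj) :
    compL F G H ≫ projL F H a = (projL G H a ⊗ₘ projL F G a) ≫ C.comp _ _ _ :=
  liftL_proj _ _ a

/-- Identities in `[A, C]_r`. -/
def idR (F : VFunctor A C) : 𝟙_ V ⟶ homR F F :=
  liftR (fun a => C.id (F.obj a)) (fun a b =>
    GradedCat.IsSquare.id_right (C := C.toGraded) (F.map a b))

/-- Identities in `[A, C]_ℓ`. -/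
def idL (F : VFunctor A C) : 𝟙_ V ⟶ homL F F :=
  liftL (fun a => C.id (F.obj a)) (fun a b =>
    GradedCat.IsSquare.id_left (C := C.toGraded) (F.map a b))

theorem idR_proj (F : VFunctor A C) (a : A.Obj) : idR F ≫ projR F F a = C.id (F.obj a) :=
  liftR_proj _ _ a

theorem idL_proj (F : VFunctor A C) (a : A.Obj) : idL F ≫ projL F F a = C.id (F.obj a) :=
  liftL_proj _ _ a

variable (A C)

/-- The `V`-enriched functor category `[A, C]_r` of Garner and López Franco. -/
def right : VCat V where
  Obj := VFunctor A C
  Hom F G := homR F G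
  id F := idR F
  comp F G H := compR F G H
  id_comp F G := homR_ext fun a => by
    rw [Category.assoc, compR_proj, ← tensorHom_id, tensorHom_comp_tensorHom_assoc, idR_proj,
      Category.id_comp, MonoidalCategory.tensorHom_def', Category.assoc, C.id_comp,
      leftUnitor_naturality]
  comp_id F G := homR_ext fun a => by
    rw [Category.assoc, compR_proj, ← id_tensorHom, tensorHom_comp_tensorHom_assoc, idR_proj,
      Category.id_comp, MonoidalCategory.tensorHom_def, Category.assoc, C.comp_id,
      rightUnitor_naturality]
  assoc F G H K := homR_ext fun a => by
    rw [Category.assoc, compR_proj, ← tensorHom_id, tensorHom_comp_tensorHom_assoc, compR_proj,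
      Category.id_comp, Category.assoc, Category.assoc, compR_proj, ← id_tensorHom,
      tensorHom_comp_tensorHom_assoc, compR_proj, Category.id_comp]
    exact C.toGraded.assoc (projR H K a) (projR G H a) (projR F G a)

/-- The `V`-enriched functor category `[A, C]_ℓ` of Garner and López Franco. -/
def left : VCat V where
  Obj := VFunctor A C
  Hom F G := homL F G
  id F := idL F
  comp F G H := compL F G H
  id_comp F G := homL_ext fun a => by
    rw [Category.assoc, compL_proj, ← tensorHom_id, tensorHom_comp_tensorHom_assoc, idL_proj,
      Category.id_comp, MonoidalCategory.tensorHom_def', Category.assoc, C.id_comp,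
      leftUnitor_naturality]
  comp_id F G := homL_ext fun a => by
    rw [Category.assoc, compL_proj, ← id_tensorHom, tensorHom_comp_tensorHom_assoc, idL_proj,
      Category.id_comp, MonoidalCategory.tensorHom_def, Category.assoc, C.comp_id,
      rightUnitor_naturality]
  assoc F G H K := homL_ext fun a => by
    rw [Category.assoc, compL_proj, ← tensorHom_id, tensorHom_comp_tensorHom_assoc, compL_proj,
      Category.id_comp, Category.assoc, Category.assoc, compL_proj, ← id_tensorHom,
      tensorHom_comp_tensorHom_assoc, compL_proj, Category.id_comp]
    exact C.toGraded.assoc (projL H K a) (projL G H a) (projL F G a)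

end GLF

end Enriched

/-! ### Presheaves and Day convolution -/

section Day

/-- The category `V̂` of presheaves on `V`. (A synonym for the functor category, so that it does not
carry the pointwise monoidal structure.) -/
def Psh (V : Type u) [SmallCategory V] : Type (u + 1) := Vᵒᵖ ⥤ Type u

variable {V : Type u} [SmallCategory V]

instance : LargeCategory (Psh V) := inferInstanceAs (LargeCategory (Vᵒᵖ ⥤ Type u))

instance : HasLimitsOfSize.{u, u} (Psh V) :=
  inferInstanceAs (HasLimitsOfSize.{u, u} (Vᵒᵖ ⥤ Type u))

namespace Psh

/-- The set `P X`. -/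
def el (P : Psh V) (X : V) : Type u := CategoryTheory.Functor.obj (C := Vᵒᵖ) (D := Type u) P (op X)

/-- The reindexing `f^* p` of `p ∈ P X` along `f : Y ⟶ X`. -/
def res {P : Psh V} {X Y : V} (f : Y ⟶ X) (p : P.el X) : P.el Y :=
  ConcreteCategory.hom (CategoryTheory.Functor.map (C := Vᵒᵖ) (D := Type u) P f.op) p

/-- The component at `X` of a morphism of presheaves. -/
def app {P Q : Psh V} (θ : P ⟶ Q) {X : V} (p : P.el X) : Q.el X :=
  ConcreteCategory.hom
    (CategoryTheory.NatTrans.app (C := Vᵒᵖ) (D := Type u) (F := P) (G := Q) θ (op X)) p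

theorem res_id {P : Psh V} {X : V} (p : P.el X) : res (𝟙 X) p = p :=
  CategoryTheory.Functor.map_id_apply (C := Vᵒᵖ) (D := Type u) P (op X) p

theorem res_res {P : Psh V} {X Y Z : V} (f : Z ⟶ Y) (g : Y ⟶ X) (p : P.el X) :
    res f (res g p) = res (f ≫ g) p :=
  (CategoryTheory.Functor.map_comp_apply (C := Vᵒᵖ) (D := Type u) P g.op f.op p).symm

theorem app_res {P Q : Psh V} (θ : P ⟶ Q) {X Y : V} (f : Y ⟶ X) (p : P.el X) :
    app θ (res f p) = res f (app θ p) :=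
  CategoryTheory.NatTrans.naturality_apply (C := Vᵒᵖ) (D := Type u) (F := P) (G := Q) θ f.op p

theorem app_id {P : Psh V} {X : V} (p : P.el X) : app (𝟙 P) p = p := rfl

theorem app_comp {P Q R : Psh V} (θ : P ⟶ Q) (η : Q ⟶ R) {X : V} (p : P.el X) :
    app (θ ≫ η) p = app η (app θ p) := rfl

theorem hom_ext {P Q : Psh V} {θ η : P ⟶ Q} (h : ∀ (X : V) (p : P.el X), app θ p = app η p) :
    θ = η :=
  CategoryTheory.NatTrans.ext (C := Vᵒᵖ) (D := Type u) (F := P) (G := Q) (funext fun X => by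
    ext p
    exact h X.unop p)

/-- Construct a presheaf from its sets and reindexing maps. -/
def mk (E : V → Type u) (r : ∀ {X Y : V}, (Y ⟶ X) → E X → E Y)
    (r_id : ∀ {X : V} (p : E X), r (𝟙 X) p = p)
    (r_r : ∀ {X Y Z : V} (f : Z ⟶ Y) (g : Y ⟶ X) (p : E X), r f (r g p) = r (f ≫ g) p) :
    Psh V :=
  ({ obj := fun X => E X.unop
     map := fun f => TypeCat.ofHom (fun p => r f.unop p)
     map_id := fun X => by ext p; exact r_id p
     map_comp := fun f g => by ext p; exact (r_r g.unop f.unop p).symm } : Vᵒᵖ ⥤ Type u)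

/-- Construct a morphism of presheaves from its components. -/
def homMk {P Q : Psh V} (t : ∀ {X : V}, P.el X → Q.el X)
    (ht : ∀ {X Y : V} (f : Y ⟶ X) (p : P.el X), t (res f p) = res f (t p)) : P ⟶ Q :=
  ({ app := fun X => TypeCat.ofHom (fun p => t (X := X.unop) p)
     naturality := fun X Y f => by ext p; exact ht f.unop p } :
    NatTrans (C := Vᵒᵖ) (D := Type u) P Q)

theorem app_homMk {P Q : Psh V} (t : ∀ {X : V}, P.el X → Q.el X)
    (ht : ∀ {X Y : V} (f : Y ⟶ X) (p : P.el X), t (res f p) = res f (t p)) {X : V} (p : P.el X) :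
    app (homMk t ht) p = t p := rfl

/-- The representable presheaf on `X`. -/
def yo (X : V) : Psh V :=
  mk (fun Y => Y ⟶ X) (fun f p => f ≫ p) (fun p => Category.id_comp p)
    (fun f g p => (Category.assoc f g p).symm)

/-- The element of `yo X` given by a morphism. -/
def toEl {X Y : V} (f : Y ⟶ X) : (yo X).el Y := f

/-- The morphism given by an element of `yo X`. -/
def ofEl {X Y : V} (f : (yo X).el Y) : Y ⟶ X := f

theorem res_toEl {X Y Z : V} (f : Z ⟶ Y) (g : Y ⟶ X) : res f (toEl g) = toEl (f ≫ g) := rfl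

theorem ofEl_res {X Y Z : V} (f : Z ⟶ Y) (g : (yo X).el Y) : ofEl (res f g) = f ≫ ofEl g := rfl

theorem ofEl_toEl {X Y : V} (f : Y ⟶ X) : ofEl (toEl f) = f := rfl

theorem toEl_ofEl {X Y : V} (f : (yo X).el Y) : toEl (ofEl f) = f := rfl

/-- The morphism of representable presheaves induced by `f`. -/
def yoMap {X Y : V} (f : X ⟶ Y) : yo X ⟶ yo Y :=
  homMk (fun p => toEl (ofEl p ≫ f)) (fun g p => Category.assoc g (ofEl p) f)

theorem app_yoMap {X Y Z : V} (f : X ⟶ Y) (p : (yo X).el Z) :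
    app (yoMap f) p = toEl (ofEl p ≫ f) := rfl

section Tensor

variable [MonoidalCategory V]

/-- Representatives of elements of the coend `∫^{Y, Z} V(X, Y ⊗ Z) × P Y × Q Z`. -/
structure Pre (P Q : Psh V) (X : V) : Type u where
  fst : V
  snd : V
  hom : X ⟶ fst ⊗ snd
  left : P.el fst
  right : Q.el snd

/-- The relation whose quotient is the coend `∫^{Y, Z} V(X, Y ⊗ Z) × P Y × Q Z`. -/
inductive Rel (P Q : Psh V) (X : V) : Pre P Q X → Pre P Q X → Prop
  | intro {Y Z Y₁ Z₁ : V} (f : X ⟶ Y ⊗ Z) (a : Y ⟶ Y₁) (b : Z ⟶ Z₁) (p : P.el Y₁) (q : Q.el Z₁) :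
      Rel P Q X ⟨Y, Z, f, res a p, res b q⟩ ⟨Y₁, Z₁, f ≫ (a ⊗ₘ b), p, q⟩

/-- The Day convolution of `P` and `Q`, `X ↦ ∫^{Y, Z} V(X, Y ⊗ Z) × P Y × Q Z`. -/
def dayObj (P Q : Psh V) : Psh V :=
  mk (fun X => Quot (Rel P Q X))
    (fun f => Quot.map (fun t => ⟨t.fst, t.snd, f ≫ t.hom, t.left, t.right⟩) (by
      rintro _ _ ⟨g, a, b, p, q⟩
      have := Rel.intro (f ≫ g) a b p q
      rwa [Category.assoc] at this))
    (by rintro X ⟨t⟩; exact congrArg (Quot.mk _) (by simp))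
    (by rintro X Y Z f g ⟨t⟩; exact congrArg (Quot.mk _) (by simp))

/-- The class of `(𝟙, p, q)`. -/
def κ₀ {P Q : Psh V} {Y Z : V} (p : P.el Y) (q : Q.el Z) : (dayObj P Q).el (Y ⊗ Z) :=
  Quot.mk _ ⟨Y, Z, 𝟙 _, p, q⟩

theorem κ₀_res {P Q : Psh V} {Y Z Y₁ Z₁ : V} (a : Y₁ ⟶ Y) (b : Z₁ ⟶ Z) (p : P.el Y) (q : Q.el Z) :
    κ₀ (res a p) (res b q) = res (a ⊗ₘ b) (κ₀ p q) := by
  refine (Quot.sound (Rel.intro (𝟙 _) a b p q)).trans (congrArg (Quot.mk _) ?_)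
  simp

theorem exists_rep₀ {P Q : Psh V} {X : V} (t : (dayObj P Q).el X) :
    ∃ (Y Z : V) (f : X ⟶ Y ⊗ Z) (p : P.el Y) (q : Q.el Z), t = res f (κ₀ p q) := by
  obtain ⟨Y, Z, f, p, q⟩ := t
  exact ⟨Y, Z, f, p, q, congrArg (Quot.mk _) (by simp)⟩

theorem hom_ext₀ {P Q R : Psh V} {θ η : dayObj P Q ⟶ R}
    (h : ∀ (Y Z : V) (p : P.el Y) (q : Q.el Z), app θ (κ₀ p q) = app η (κ₀ p q)) : θ = η := by
  refine hom_ext fun X t => ?_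
  obtain ⟨Y, Z, f, p, q, rfl⟩ := exists_rep₀ t
  rw [app_res, app_res, h]

/-- The morphism out of a Day convolution given by a natural family of maps
`P Y × Q Z → R (Y ⊗ Z)`. -/
def desc₀ {P Q R : Psh V} (t : ∀ Y Z : V, P.el Y → Q.el Z → R.el (Y ⊗ Z))
    (ht : ∀ (Y Z Y₁ Z₁ : V) (a : Y₁ ⟶ Y) (b : Z₁ ⟶ Z) (p : P.el Y) (q : Q.el Z),
      t _ _ (res a p) (res b q) = res (a ⊗ₘ b) (t _ _ p q)) : dayObj P Q ⟶ R :=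
  homMk (fun s => Quot.lift (fun s => res s.hom (t _ _ s.left s.right)) (by
      rintro _ _ ⟨g, a, b, p, q⟩
      simp only [ht, res_res]) s)
    (by rintro X Y f ⟨s⟩; exact (res_res _ _ _).symm)

theorem app_desc₀ {P Q R : Psh V} (t : ∀ Y Z : V, P.el Y → Q.el Z → R.el (Y ⊗ Z))
    (ht : ∀ (Y Z Y₁ Z₁ : V) (a : Y₁ ⟶ Y) (b : Z₁ ⟶ Z) (p : P.el Y) (q : Q.el Z),
      t _ _ (res a p) (res b q) = res (a ⊗ₘ b) (t _ _ p q)) {Y Z : V} (p : P.el Y) (q : Q.el Z) :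
    app (desc₀ t ht) (κ₀ p q) = t _ _ p q :=
  res_id _

/-- The presheaf `T (- ⊗ Z)`. -/
def shiftR (T : Psh V) (Z : V) : Psh V :=
  mk (fun X => T.el (X ⊗ Z)) (fun f s => res (f ⊗ₘ 𝟙 Z) s)
    (fun s => by rw [id_tensorHom_id, res_id])
    (fun f g s => by rw [res_res, tensorHom_comp_tensorHom, Category.comp_id])

/-- The presheaf `T (Z ⊗ -)`. -/
def shiftL (T : Psh V) (Z : V) : Psh V :=
  mk (fun X => T.el (Z ⊗ X)) (fun f s => res (𝟙 Z ⊗ₘ f) s)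
    (fun s => by rw [id_tensorHom_id, res_id])
    (fun f g s => by rw [res_res, tensorHom_comp_tensorHom, Category.comp_id])

/-- An element of `T (X ⊗ Z)`, as an element of `shiftR T Z`. -/
def toShiftR {T : Psh V} {X Z : V} (s : T.el (X ⊗ Z)) : (shiftR T Z).el X := s

/-- An element of `shiftR T Z`, as an element of `T (X ⊗ Z)`. -/
def ofShiftR {T : Psh V} {X Z : V} (s : (shiftR T Z).el X) : T.el (X ⊗ Z) := s

/-- An element of `T (Z ⊗ X)`, as an element of `shiftL T Z`. -/
def toShiftL {T : Psh V} {X Z : V} (s : T.el (Z ⊗ X)) : (shiftL T Z).el X := s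

/-- An element of `shiftL T Z`, as an element of `T (Z ⊗ X)`. -/
def ofShiftL {T : Psh V} {X Z : V} (s : (shiftL T Z).el X) : T.el (Z ⊗ X) := s

theorem ofShiftR_res {T : Psh V} {Z X Y : V} (f : Y ⟶ X) (s : (shiftR T Z).el X) :
    ofShiftR (res f s) = res (f ⊗ₘ 𝟙 Z) (ofShiftR s) := rfl

theorem ofShiftL_res {T : Psh V} {Z X Y : V} (f : Y ⟶ X) (s : (shiftL T Z).el X) :
    ofShiftL (res f s) = res (𝟙 Z ⊗ₘ f) (ofShiftL s) := rfl

theorem ofShiftR_toShiftR {T : Psh V} {X Z : V} (s : T.el (X ⊗ Z)) :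
    ofShiftR (toShiftR s) = s := rfl

theorem ofShiftL_toShiftL {T : Psh V} {X Z : V} (s : T.el (Z ⊗ X)) :
    ofShiftL (toShiftL s) = s := rfl

section

variable {P Q R T : Psh V}

section

variable (t : ∀ X Y Z : V, P.el X → Q.el Y → R.el Z → T.el ((X ⊗ Y) ⊗ Z))
  (ht : ∀ (X Y Z X₁ Y₁ Z₁ : V) (a : X₁ ⟶ X) (b : Y₁ ⟶ Y) (c : Z₁ ⟶ Z) (p : P.el X) (q : Q.el Y)
    (r : R.el Z), t _ _ _ (res a p) (res b q) (res c r) = res ((a ⊗ₘ b) ⊗ₘ c) (t _ _ _ p q r))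

theorem descL_aux (t : ∀ X Y Z : V, P.el X → Q.el Y → R.el Z → T.el ((X ⊗ Y) ⊗ Z))
    (ht : ∀ (X Y Z X₁ Y₁ Z₁ : V) (a : X₁ ⟶ X) (b : Y₁ ⟶ Y) (c : Z₁ ⟶ Z) (p : P.el X) (q : Q.el Y)
      (r : R.el Z), t _ _ _ (res a p) (res b q) (res c r) = res ((a ⊗ₘ b) ⊗ₘ c) (t _ _ _ p q r))
    {X Y X₁ Y₁ Z : V} (a : X₁ ⟶ X) (b : Y₁ ⟶ Y) (p : P.el X) (q : Q.el Y)
    (r : R.el Z) : toShiftR (t _ _ _ (res a p) (res b q) r) = res (a ⊗ₘ b) (toShiftR (t _ _ _ p q r)) := by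
  have := ht _ _ _ _ _ _ a b (𝟙 Z) p q r
  rw [res_id] at this
  exact this

/-- Auxiliary to `descL`. -/
def descL₁ {Z : V} (r : R.el Z) : dayObj P Q ⟶ shiftR T Z :=
  desc₀ (fun _ _ p q => toShiftR (t _ _ _ p q r)) (fun _ _ _ _ a b p q => descL_aux t ht a b p q r)

/-- The morphism out of `(P ⊗ Q) ⊗ R` given by a natural family of maps
`P X × Q Y × R Z → T ((X ⊗ Y) ⊗ Z)`. -/
def descL : dayObj (dayObj P Q) R ⟶ T :=
  desc₀ (fun _ _ s r => ofShiftR (app (descL₁ t ht r) s)) (by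
    intro Y Z Y₁ Z₁ a b s r
    obtain ⟨_, _, f, p, q, rfl⟩ := exists_rep₀ s
    rw [res_res, app_res, app_res, descL₁, descL₁, app_desc₀, app_desc₀, ofShiftR_res, ofShiftR_res,
      ofShiftR_toShiftR, ofShiftR_toShiftR, res_res]
    have := ht _ _ _ _ _ _ (𝟙 _) (𝟙 _) b p q r
    rw [res_id, res_id] at this
    rw [this, res_res, id_tensorHom_id, tensorHom_comp_tensorHom, tensorHom_comp_tensorHom,
      Category.comp_id, Category.comp_id, Category.id_comp])

theorem app_descL {X Y Z : V} (p : P.el X) (q : Q.el Y) (r : R.el Z) :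
    app (descL t ht) (κ₀ (κ₀ p q) r) = t _ _ _ p q r := by
  rw [descL, app_desc₀, descL₁, app_desc₀, ofShiftR_toShiftR]

end

section

variable (t : ∀ X Y Z : V, P.el X → Q.el Y → R.el Z → T.el (X ⊗ (Y ⊗ Z)))
  (ht : ∀ (X Y Z X₁ Y₁ Z₁ : V) (a : X₁ ⟶ X) (b : Y₁ ⟶ Y) (c : Z₁ ⟶ Z) (p : P.el X) (q : Q.el Y)
    (r : R.el Z), t _ _ _ (res a p) (res b q) (res c r) = res (a ⊗ₘ (b ⊗ₘ c)) (t _ _ _ p q r))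

theorem descR_aux (t : ∀ X Y Z : V, P.el X → Q.el Y → R.el Z → T.el (X ⊗ (Y ⊗ Z)))
    (ht : ∀ (X Y Z X₁ Y₁ Z₁ : V) (a : X₁ ⟶ X) (b : Y₁ ⟶ Y) (c : Z₁ ⟶ Z) (p : P.el X) (q : Q.el Y)
      (r : R.el Z), t _ _ _ (res a p) (res b q) (res c r) = res (a ⊗ₘ (b ⊗ₘ c)) (t _ _ _ p q r))
    {X Y Z Y₁ Z₁ : V} (b : Y₁ ⟶ Y) (c : Z₁ ⟶ Z) (p : P.el X) (q : Q.el Y)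
    (r : R.el Z) : toShiftL (t _ _ _ p (res b q) (res c r)) = res (b ⊗ₘ c) (toShiftL (t _ _ _ p q r)) := by
  have := ht _ _ _ _ _ _ (𝟙 X) b c p q r
  rw [res_id] at this
  exact this

/-- Auxiliary to `descR`. -/
def descR₁ {X : V} (p : P.el X) : dayObj Q R ⟶ shiftL T X :=
  desc₀ (fun _ _ q r => toShiftL (t _ _ _ p q r)) (fun _ _ _ _ b c q r => descR_aux t ht b c p q r)

/-- The morphism out of `P ⊗ (Q ⊗ R)` given by a natural family of maps
`P X × Q Y × R Z → T (X ⊗ (Y ⊗ Z))`. -/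
def descR : dayObj P (dayObj Q R) ⟶ T :=
  desc₀ (fun _ _ p s => ofShiftL (app (descR₁ t ht p) s)) (by
    intro Y Z Y₁ Z₁ a b p s
    obtain ⟨_, _, f, q, r, rfl⟩ := exists_rep₀ s
    rw [res_res, app_res, app_res, descR₁, descR₁, app_desc₀, app_desc₀, ofShiftL_res, ofShiftL_res,
      ofShiftL_toShiftL, ofShiftL_toShiftL, res_res]
    have := ht _ _ _ _ _ _ a (𝟙 _) (𝟙 _) p q r
    rw [res_id, res_id] at this
    rw [this, res_res, id_tensorHom_id, tensorHom_comp_tensorHom, tensorHom_comp_tensorHom,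
      Category.comp_id, Category.comp_id, Category.id_comp])

theorem app_descR {X Y Z : V} (p : P.el X) (q : Q.el Y) (r : R.el Z) :
    app (descR t ht) (κ₀ p (κ₀ q r)) = t _ _ _ p q r := by
  rw [descR, app_desc₀, descR₁, app_desc₀, ofShiftL_toShiftL]

end

theorem κ₀_res_left {Y Z Y₁ : V} (a : Y₁ ⟶ Y) (p : P.el Y) (q : Q.el Z) :
    κ₀ (res a p) q = res (a ⊗ₘ 𝟙 Z) (κ₀ p q) := by
  rw [← κ₀_res, res_id]

theorem κ₀_res_right {Y Z Z₁ : V} (b : Z₁ ⟶ Z) (p : P.el Y) (q : Q.el Z) :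
    κ₀ p (res b q) = res (𝟙 Y ⊗ₘ b) (κ₀ p q) := by
  rw [← κ₀_res, res_id]

theorem hom_extL {θ η : dayObj (dayObj P Q) R ⟶ T}
    (h : ∀ (X Y Z : V) (p : P.el X) (q : Q.el Y) (r : R.el Z),
      app θ (κ₀ (κ₀ p q) r) = app η (κ₀ (κ₀ p q) r)) : θ = η := by
  refine hom_ext₀ fun Y Z s r => ?_
  obtain ⟨_, _, f, p, q, rfl⟩ := exists_rep₀ s
  rw [κ₀_res_left, app_res, app_res, h]

theorem hom_extR {θ η : dayObj P (dayObj Q R) ⟶ T}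
    (h : ∀ (X Y Z : V) (p : P.el X) (q : Q.el Y) (r : R.el Z),
      app θ (κ₀ p (κ₀ q r)) = app η (κ₀ p (κ₀ q r))) : θ = η := by
  refine hom_ext₀ fun Y Z p s => ?_
  obtain ⟨_, _, f, q, r, rfl⟩ := exists_rep₀ s
  rw [κ₀_res_right, app_res, app_res, h]

end

/-- Day convolution of morphisms. -/
def dayHom {P Q P₁ Q₁ : Psh V} (θ : P ⟶ P₁) (η : Q ⟶ Q₁) : dayObj P Q ⟶ dayObj P₁ Q₁ :=
  desc₀ (fun _ _ p q => κ₀ (app θ p) (app η q)) (fun _ _ _ _ a b p q => by rw [app_res, app_res, κ₀_res])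

theorem app_dayHom {P Q P₁ Q₁ : Psh V} (θ : P ⟶ P₁) (η : Q ⟶ Q₁) {Y Z : V} (p : P.el Y)
    (q : Q.el Z) : app (dayHom θ η) (κ₀ p q) = κ₀ (app θ p) (app η q) := by
  rw [dayHom, app_desc₀]

/-- The associator of Day convolution. -/
def dayAssoc (P Q R : Psh V) : dayObj (dayObj P Q) R ≅ dayObj P (dayObj Q R) where
  hom := descL (fun _ _ _ p q r => res (α_ _ _ _).hom (κ₀ p (κ₀ q r))) (fun _ _ _ _ _ _ a b c p q r => by
    rw [κ₀_res, κ₀_res, res_res, res_res, MonoidalCategory.associator_naturality])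
  inv := descR (fun _ _ _ p q r => res (α_ _ _ _).inv (κ₀ (κ₀ p q) r)) (fun _ _ _ _ _ _ a b c p q r => by
    rw [κ₀_res, κ₀_res, res_res, res_res, associator_inv_naturality])
  hom_inv_id := hom_extL fun X Y Z p q r => by
    rw [app_comp, app_descL, app_res, app_descR, res_res, Iso.hom_inv_id, res_id, app_id]
  inv_hom_id := hom_extR fun X Y Z p q r => by
    rw [app_comp, app_descR, app_res, app_descL, res_res, Iso.inv_hom_id, res_id, app_id]

theorem app_dayAssoc {P Q R : Psh V} {X Y Z : V} (p : P.el X) (q : Q.el Y) (r : R.el Z) :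
    app (dayAssoc P Q R).hom (κ₀ (κ₀ p q) r) = res (α_ _ _ _).hom (κ₀ p (κ₀ q r)) := by
  simp only [dayAssoc, app_descL]

/-- The left unitor of Day convolution. -/
def dayLeftUnitor (P : Psh V) : dayObj (yo (𝟙_ V)) P ≅ P where
  hom := desc₀ (fun Y Z j p => res ((ofEl j ⊗ₘ 𝟙 Z) ≫ (λ_ Z).hom) p) (fun _ _ _ _ a b j p => by
    rw [res_res, res_res, ofEl_res, Category.assoc,
      ← leftUnitor_naturality, ← id_tensorHom, tensorHom_comp_tensorHom_assoc,
      tensorHom_comp_tensorHom_assoc]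
    simp)
  inv := homMk (fun {X} p => res (λ_ X).inv (κ₀ (toEl (𝟙 (𝟙_ V))) p)) (fun {X Y} f p => by
    rw [κ₀_res_right, res_res, res_res]
    simp)
  hom_inv_id := hom_ext₀ fun Y Z j p => by
    rw [app_comp, app_desc₀, app_homMk, κ₀_res_right, res_res, app_id]
    conv_rhs => rw [← toEl_ofEl j, ← Category.comp_id (ofEl j), ← res_toEl, κ₀_res_left]
    simp
  inv_hom_id := hom_ext fun X p => by
    rw [app_comp, app_homMk, app_res, app_desc₀, ofEl_toEl, res_res, app_id]
    simp [res_id]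

theorem app_dayLeftUnitor {P : Psh V} {Y Z : V} (j : (yo (𝟙_ V)).el Y) (p : P.el Z) :
    app (dayLeftUnitor P).hom (κ₀ j p) = res ((ofEl j ⊗ₘ 𝟙 Z) ≫ (λ_ Z).hom) p := by
  simp only [dayLeftUnitor, app_desc₀]

/-- The right unitor of Day convolution. -/
def dayRightUnitor (P : Psh V) : dayObj P (yo (𝟙_ V)) ≅ P where
  hom := desc₀ (fun Y Z p j => res ((𝟙 Y ⊗ₘ ofEl j) ≫ (ρ_ Y).hom) p) (fun _ _ _ _ a b p j => by
    rw [res_res, res_res, ofEl_res, Category.assoc,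
      ← rightUnitor_naturality, ← tensorHom_id, tensorHom_comp_tensorHom_assoc,
      tensorHom_comp_tensorHom_assoc]
    simp)
  inv := homMk (fun {X} p => res (ρ_ X).inv (κ₀ p (toEl (𝟙 (𝟙_ V))))) (fun {X Y} f p => by
    rw [κ₀_res_left, res_res, res_res]
    simp)
  hom_inv_id := hom_ext₀ fun Y Z p j => by
    rw [app_comp, app_desc₀, app_homMk, κ₀_res_left, res_res, app_id]
    conv_rhs => rw [← toEl_ofEl j, ← Category.comp_id (ofEl j), ← res_toEl, κ₀_res_right]
    simp
  inv_hom_id := hom_ext fun X p => by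
    rw [app_comp, app_homMk, app_res, app_desc₀, ofEl_toEl, res_res, app_id]
    simp [res_id]

theorem app_dayRightUnitor {P : Psh V} {Y Z : V} (p : P.el Y) (j : (yo (𝟙_ V)).el Z) :
    app (dayRightUnitor P).hom (κ₀ p j) = res ((𝟙 Y ⊗ₘ ofEl j) ≫ (ρ_ Y).hom) p := by
  simp only [dayRightUnitor, app_desc₀]

variable (V) in
/-- Auxiliary to `dayMonoidal`. -/
abbrev dayStruct : MonoidalCategoryStruct (Psh V) where
  tensorObj := dayObj
  whiskerLeft P _ _ θ := dayHom (𝟙 P) θ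
  whiskerRight θ P := dayHom θ (𝟙 P)
  tensorHom := dayHom
  tensorUnit := yo (𝟙_ V)
  associator := dayAssoc
  leftUnitor := dayLeftUnitor
  rightUnitor := dayRightUnitor

/-- The Day convolution monoidal structure on `V̂`. -/
instance dayMonoidal : MonoidalCategory (Psh V) :=
  letI := dayStruct V
  MonoidalCategory.ofTensorHom
    (id_tensorHom_id := fun P Q => hom_ext₀ fun Y Z p q => app_dayHom _ _ _ _)
    (tensorHom_comp_tensorHom := fun θ η θ₁ η₁ => hom_ext₀ fun Y Z p q => by
      change app (dayHom θ η ≫ dayHom θ₁ η₁) _ = app (dayHom (θ ≫ θ₁) (η ≫ η₁)) _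
      simp only [app_comp, app_dayHom])
    (associator_naturality := fun θ η ζ => hom_extL fun X Y Z p q r => by
      change app (dayHom (dayHom θ η) ζ ≫ (dayAssoc _ _ _).hom) _ =
        app ((dayAssoc _ _ _).hom ≫ dayHom θ (dayHom η ζ)) _
      simp only [app_comp, app_dayHom, app_dayAssoc, app_res])
    (leftUnitor_naturality := fun θ => hom_ext₀ fun Y Z j p => by
      change app (dayHom (𝟙 _) θ ≫ (dayLeftUnitor _).hom) _ = app ((dayLeftUnitor _).hom ≫ θ) _
      simp only [app_comp, app_dayHom, app_dayLeftUnitor, app_res, app_id])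
    (rightUnitor_naturality := fun θ => hom_ext₀ fun Y Z p j => by
      change app (dayHom θ (𝟙 _) ≫ (dayRightUnitor _).hom) _ = app ((dayRightUnitor _).hom ≫ θ) _
      simp only [app_comp, app_dayHom, app_dayRightUnitor, app_res, app_id])
    (pentagon := fun P Q R S => hom_ext₀ fun W Z s q => by
      obtain ⟨_, _, f, s, r, rfl⟩ := exists_rep₀ s
      obtain ⟨_, _, g, p, p₁, rfl⟩ := exists_rep₀ s
      change app (dayHom (dayAssoc P Q R).hom (𝟙 S) ≫ (dayAssoc _ _ _).hom ≫
          dayHom (𝟙 P) (dayAssoc _ _ _).hom) _ =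
        app ((dayAssoc (dayObj P Q) R S).hom ≫ (dayAssoc P Q (dayObj R S)).hom) _
      simp only [app_comp, app_dayHom, app_dayAssoc, app_res, κ₀_res_left, κ₀_res_right, app_id,
        res_res]
      congr 1
      simp)
    (triangle := fun P Q => hom_extL fun X Y Z p j q => by
      change app ((dayAssoc _ _ _).hom ≫ dayHom (𝟙 P) (dayLeftUnitor _).hom) _ =
        app (dayHom (dayRightUnitor _).hom (𝟙 Q)) _
      simp only [app_comp, app_dayHom, app_dayAssoc, app_dayLeftUnitor, app_dayRightUnitor,
        app_res, κ₀_res_left, κ₀_res_right, app_id, res_res]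
      congr 1
      simp)

end Tensor

section Tensor

variable [MonoidalCategory V]

/-- The class of `(𝟙, p, q)` in the Day convolution `P ⊗ Q`. -/
def κ {P Q : Psh V} {Y Z : V} (p : P.el Y) (q : Q.el Z) : (P ⊗ Q).el (Y ⊗ Z) := κ₀ p q

theorem κ_res {P Q : Psh V} {Y Z Y₁ Z₁ : V} (a : Y₁ ⟶ Y) (b : Z₁ ⟶ Z) (p : P.el Y) (q : Q.el Z) :
    κ (res a p) (res b q) = res (a ⊗ₘ b) (κ p q) := κ₀_res a b p q

theorem κ_res_left {P Q : Psh V} {Y Z Y₁ : V} (a : Y₁ ⟶ Y) (p : P.el Y) (q : Q.el Z) :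
    κ (res a p) q = res (a ⊗ₘ 𝟙 Z) (κ p q) := κ₀_res_left a p q

theorem κ_res_right {P Q : Psh V} {Y Z Z₁ : V} (b : Z₁ ⟶ Z) (p : P.el Y) (q : Q.el Z) :
    κ p (res b q) = res (𝟙 Y ⊗ₘ b) (κ p q) := κ₀_res_right b p q

theorem exists_rep {P Q : Psh V} {X : V} (t : (P ⊗ Q).el X) :
    ∃ (Y Z : V) (f : X ⟶ Y ⊗ Z) (p : P.el Y) (q : Q.el Z), t = res f (κ p q) := exists_rep₀ t

theorem tensor_ext {P Q R : Psh V} {θ η : P ⊗ Q ⟶ R}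
    (h : ∀ (Y Z : V) (p : P.el Y) (q : Q.el Z), app θ (κ p q) = app η (κ p q)) : θ = η :=
  hom_ext₀ h

theorem app_tensorHom {P Q P₁ Q₁ : Psh V} (θ : P ⟶ P₁) (η : Q ⟶ Q₁) {Y Z : V} (p : P.el Y)
    (q : Q.el Z) : app (θ ⊗ₘ η) (κ p q) = κ (app θ p) (app η q) := app_dayHom θ η p q

theorem app_whiskerLeft {P Q Q₁ : Psh V} (η : Q ⟶ Q₁) {Y Z : V} (p : P.el Y)
    (q : Q.el Z) : app (P ◁ η) (κ p q) = κ p (app η q) := app_dayHom (𝟙 P) η p q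

theorem app_whiskerRight {P Q P₁ : Psh V} (θ : P ⟶ P₁) {Y Z : V} (p : P.el Y)
    (q : Q.el Z) : app (θ ▷ Q) (κ p q) = κ (app θ p) q := app_dayHom θ (𝟙 Q) p q

theorem app_associator {P Q R : Psh V} {X Y Z : V} (p : P.el X) (q : Q.el Y) (r : R.el Z) :
    app (α_ P Q R).hom (κ (κ p q) r) = res (α_ _ _ _).hom (κ p (κ q r)) := app_dayAssoc p q r

/-- A morphism `Y ⟶ I` as an element of the unit presheaf. -/
def toUnit {Y : V} (j : Y ⟶ 𝟙_ V) : (𝟙_ (Psh V)).el Y := toEl j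

theorem res_toUnit {Y Z : V} (f : Z ⟶ Y) (j : Y ⟶ 𝟙_ V) : res f (toUnit j) = toUnit (f ≫ j) := rfl

/-- The morphism given by an element of the unit presheaf. -/
def ofUnit {Y : V} (j : (𝟙_ (Psh V)).el Y) : Y ⟶ 𝟙_ V := ofEl j

theorem ofUnit_res {Y Z : V} (f : Z ⟶ Y) (j : (𝟙_ (Psh V)).el Y) :
    ofUnit (res f j) = f ≫ ofUnit j := rfl

theorem ofUnit_toUnit {Y : V} (j : Y ⟶ 𝟙_ V) : ofUnit (toUnit j) = j := rfl

theorem unit_cases {Y : V} {motive : (𝟙_ (Psh V)).el Y → Prop} (h : ∀ j, motive (toUnit j))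
    (j : (𝟙_ (Psh V)).el Y) : motive j := h j

theorem toUnit_eq {X : V} (j : X ⟶ 𝟙_ V) : toUnit j = res j (toUnit (𝟙 (𝟙_ V))) := by
  rw [res_toUnit, Category.comp_id]

theorem app_leftUnitor {P : Psh V} {Y Z : V} (j : Y ⟶ 𝟙_ V) (p : P.el Z) :
    app (λ_ P).hom (κ (toUnit j) p) = res ((j ⊗ₘ 𝟙 Z) ≫ (λ_ Z).hom) p := app_dayLeftUnitor _ _

theorem app_rightUnitor {P : Psh V} {Y Z : V} (p : P.el Y) (j : Z ⟶ 𝟙_ V) :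
    app (ρ_ P).hom (κ p (toUnit j)) = res ((𝟙 Y ⊗ₘ j) ≫ (ρ_ Y).hom) p := app_dayRightUnitor _ _

end Tensor

section Closed

variable [MonoidalCategory V]

/-- The internal hom of `V̂` for which `dayIhomL P` is right adjoint to `P ⊗ -`. -/
def dayIhomL (P T : Psh V) : Psh V :=
  mk (fun W => { h : ∀ Z : V, P.el Z → T.el (Z ⊗ W) //
      ∀ (Z Z₁ : V) (a : Z₁ ⟶ Z) (p : P.el Z), h Z₁ (res a p) = res (a ⊗ₘ 𝟙 W) (h Z p) })
    (fun f h => ⟨fun Z p => res (𝟙 Z ⊗ₘ f) (h.1 Z p), fun Z Z₁ a p => by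
      beta_reduce
      rw [h.2, res_res, res_res, tensorHom_comp_tensorHom, tensorHom_comp_tensorHom]
      simp⟩)
    (fun h => Subtype.ext (funext fun Z => funext fun p => by
      change res (𝟙 Z ⊗ₘ 𝟙 _) (h.1 Z p) = h.1 Z p
      rw [id_tensorHom_id, res_id]))
    (fun f g h => Subtype.ext (funext fun Z => funext fun p => by
      change res (𝟙 Z ⊗ₘ f) (res (𝟙 Z ⊗ₘ g) (h.1 Z p)) = res (𝟙 Z ⊗ₘ (f ≫ g)) (h.1 Z p)
      rw [res_res, tensorHom_comp_tensorHom, Category.comp_id]))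

/-- The internal hom of `V̂` for which `dayIhomR P` is right adjoint to `- ⊗ P`. -/
def dayIhomR (P T : Psh V) : Psh V :=
  mk (fun W => { h : ∀ Z : V, P.el Z → T.el (W ⊗ Z) //
      ∀ (Z Z₁ : V) (a : Z₁ ⟶ Z) (p : P.el Z), h Z₁ (res a p) = res (𝟙 W ⊗ₘ a) (h Z p) })
    (fun f h => ⟨fun Z p => res (f ⊗ₘ 𝟙 Z) (h.1 Z p), fun Z Z₁ a p => by
      beta_reduce
      rw [h.2, res_res, res_res, tensorHom_comp_tensorHom, tensorHom_comp_tensorHom]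
      simp⟩)
    (fun h => Subtype.ext (funext fun Z => funext fun p => by
      change res (𝟙 _ ⊗ₘ 𝟙 Z) (h.1 Z p) = h.1 Z p
      rw [id_tensorHom_id, res_id]))
    (fun f g h => Subtype.ext (funext fun Z => funext fun p => by
      change res (f ⊗ₘ 𝟙 Z) (res (g ⊗ₘ 𝟙 Z) (h.1 Z p)) = res ((f ≫ g) ⊗ₘ 𝟙 Z) (h.1 Z p)
      rw [res_res, tensorHom_comp_tensorHom, Category.comp_id]))

/-- The adjunction between `P ⊗ -` and `dayIhomL P`, on hom-sets. -/
def dayEquivL (P Q T : Psh V) : (P ⊗ Q ⟶ T) ≃ (Q ⟶ dayIhomL P T) where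
  toFun θ := homMk (Q := dayIhomL P T)
    (fun q => ⟨fun Z p => app θ (κ p q), fun Z Z₁ a p =>
      (congrArg (app θ) (κ_res_left a p q)).trans (app_res θ _ _)⟩)
    (fun f q => Subtype.ext (funext fun Z => funext fun p => by
      change app θ (κ p (res f q)) = res (𝟙 Z ⊗ₘ f) (app θ (κ p q))
      rw [κ_res_right, app_res]))
  invFun η := desc₀ (fun Y Z p q => (app η q).1 Y p) (fun Y Z Y₁ Z₁ a b p q => by
    rw [app_res]
    change res (𝟙 _ ⊗ₘ b) ((app η q).1 _ (res a p)) = _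
    rw [(app η q).2, res_res, tensorHom_comp_tensorHom, Category.comp_id, Category.id_comp])
  left_inv θ := tensor_ext fun Y Z p q => app_desc₀ _ _ _ _
  right_inv η := hom_ext fun X q => Subtype.ext (funext fun Z => funext fun p =>
    app_desc₀ _ _ _ _)

/-- The adjunction between `- ⊗ P` and `dayIhomR P`, on hom-sets. -/
def dayEquivR (P Q T : Psh V) : (Q ⊗ P ⟶ T) ≃ (Q ⟶ dayIhomR P T) where
  toFun θ := homMk (Q := dayIhomR P T)
    (fun q => ⟨fun Z p => app θ (κ q p), fun Z Z₁ a p =>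
      (congrArg (app θ) (κ_res_right a q p)).trans (app_res θ _ _)⟩)
    (fun f q => Subtype.ext (funext fun Z => funext fun p => by
      change app θ (κ (res f q) p) = res (f ⊗ₘ 𝟙 Z) (app θ (κ q p))
      rw [κ_res_left, app_res]))
  invFun η := desc₀ (fun Y Z q p => (app η q).1 Z p) (fun Y Z Y₁ Z₁ a b q p => by
    rw [app_res]
    change res (a ⊗ₘ 𝟙 _) ((app η q).1 _ (res b p)) = _
    rw [(app η q).2, res_res, tensorHom_comp_tensorHom, Category.comp_id, Category.id_comp])
  left_inv θ := tensor_ext fun Y Z p q => app_desc₀ _ _ _ _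
  right_inv η := hom_ext fun X q => Subtype.ext (funext fun Z => funext fun p =>
    app_desc₀ _ _ _ _)

theorem isLeftAdjoint_tensorLeft (P : Psh V) : (tensorLeft P).IsLeftAdjoint :=
  (Adjunction.adjunctionOfEquivRight (F := tensorLeft P) (fun Q T => dayEquivL P Q T)
    (fun Q Q₁ T f θ => hom_ext fun X q => Subtype.ext (funext fun Z => funext fun p => by
      change app (P ◁ f ≫ θ) (κ p q) = app θ (κ p (app f q))
      rw [app_comp, app_whiskerLeft]))).isLeftAdjoint

theorem isLeftAdjoint_tensorRight (P : Psh V) : (tensorRight P).IsLeftAdjoint :=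
  (Adjunction.adjunctionOfEquivRight (F := tensorRight P) (fun Q T => dayEquivR P Q T)
    (fun Q Q₁ T f θ => hom_ext fun X q => Subtype.ext (funext fun Z => funext fun p => by
      change app (f ▷ P ≫ θ) (κ q p) = app θ (κ (app f q) p)
      rw [app_comp, app_whiskerRight]))).isLeftAdjoint

end Closed

section Star

variable [S : StarMonoidal V]

/-- The second monoidal structure on `V̂`, by Day convolution of the second monoidal structure
on `V`. -/
instance : StarMonoidal (Psh V) where
  star := @dayMonoidal V _ S.star

/-- The class of `(𝟙, p, q)` in the Day convolution `P ⋆ Q`. -/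
def κs {P Q : Psh V} {Y Z : V} (p : P.el Y) (q : Q.el Z) : (P ⋆ Q).el (Y ⋆ Z) :=
  @κ₀ V _ S.star P Q Y Z p q

theorem κs_res {P Q : Psh V} {Y Z Y₁ Z₁ : V} (a : Y₁ ⟶ Y) (b : Z₁ ⟶ Z) (p : P.el Y) (q : Q.el Z) :
    κs (res a p) (res b q) = res (a ⋆ₘ b) (κs p q) := @κ₀_res V _ S.star _ _ _ _ _ _ a b p q

theorem κs_res_left {P Q : Psh V} {Y Z Y₁ : V} (a : Y₁ ⟶ Y) (p : P.el Y) (q : Q.el Z) :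
    κs (res a p) q = res (a ⋆ₘ 𝟙 Z) (κs p q) := @κ₀_res_left V _ S.star _ _ _ _ _ a p q

theorem κs_res_right {P Q : Psh V} {Y Z Z₁ : V} (b : Z₁ ⟶ Z) (p : P.el Y) (q : Q.el Z) :
    κs p (res b q) = res (𝟙 Y ⋆ₘ b) (κs p q) := @κ₀_res_right V _ S.star _ _ _ _ _ b p q

theorem exists_rep_star {P Q : Psh V} {X : V} (t : (P ⋆ Q).el X) :
    ∃ (Y Z : V) (f : X ⟶ Y ⋆ Z) (p : P.el Y) (q : Q.el Z), t = res f (κs p q) :=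
  @exists_rep₀ V _ S.star P Q X t

theorem star_ext {P Q R : Psh V} {θ η : P ⋆ Q ⟶ R}
    (h : ∀ (Y Z : V) (p : P.el Y) (q : Q.el Z), app θ (κs p q) = app η (κs p q)) : θ = η :=
  @hom_ext₀ V _ S.star P Q R θ η h

/-- The morphism out of `P ⋆ Q` given by a natural family of maps `P Y × Q Z → R (Y ⋆ Z)`. -/
def starDesc {P Q R : Psh V} (t : ∀ Y Z : V, P.el Y → Q.el Z → R.el (Y ⋆ Z))
    (ht : ∀ (Y Z Y₁ Z₁ : V) (a : Y₁ ⟶ Y) (b : Z₁ ⟶ Z) (p : P.el Y) (q : Q.el Z),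
      t _ _ (res a p) (res b q) = res (a ⋆ₘ b) (t _ _ p q)) : P ⋆ Q ⟶ R :=
  @desc₀ V _ S.star P Q R t ht

theorem app_starDesc {P Q R : Psh V} (t : ∀ Y Z : V, P.el Y → Q.el Z → R.el (Y ⋆ Z))
    (ht : ∀ (Y Z Y₁ Z₁ : V) (a : Y₁ ⟶ Y) (b : Z₁ ⟶ Z) (p : P.el Y) (q : Q.el Z),
      t _ _ (res a p) (res b q) = res (a ⋆ₘ b) (t _ _ p q)) {Y Z : V} (p : P.el Y) (q : Q.el Z) :
    app (starDesc t ht) (κs p q) = t _ _ p q :=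
  @app_desc₀ V _ S.star P Q R t ht Y Z p q

theorem app_starHom {P Q P₁ Q₁ : Psh V} (θ : P ⟶ P₁) (η : Q ⟶ Q₁) {Y Z : V} (p : P.el Y)
    (q : Q.el Z) : app (θ ⋆ₘ η) (κs p q) = κs (app θ p) (app η q) :=
  @app_dayHom V _ S.star _ _ _ _ θ η _ _ p q

theorem app_starAssoc {P Q R : Psh V} {X Y Z : V} (p : P.el X) (q : Q.el Y) (r : R.el Z) :
    app (starAssoc P Q R).hom (κs (κs p q) r) = res (starAssoc _ _ _).hom (κs p (κs q r)) :=
  @app_dayAssoc V _ S.star _ _ _ _ _ _ p q r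

/-- A morphism `Y ⟶ J` as an element of the second unit presheaf. -/
def toStarUnit {Y : V} (j : Y ⟶ starUnit V) : (starUnit (Psh V)).el Y := toEl j

theorem res_toStarUnit {Y Z : V} (f : Z ⟶ Y) (j : Y ⟶ starUnit V) :
    res f (toStarUnit j) = toStarUnit (f ≫ j) := rfl

/-- The morphism given by an element of the second unit presheaf. -/
def ofStarUnit {Y : V} (j : (starUnit (Psh V)).el Y) : Y ⟶ starUnit V := ofEl j

theorem ofStarUnit_res {Y Z : V} (f : Z ⟶ Y) (j : (starUnit (Psh V)).el Y) :
    ofStarUnit (res f j) = f ≫ ofStarUnit j := rfl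

theorem ofStarUnit_toStarUnit {Y : V} (j : Y ⟶ starUnit V) : ofStarUnit (toStarUnit j) = j := rfl

theorem starUnit_cases {Y : V} {motive : (starUnit (Psh V)).el Y → Prop}
    (h : ∀ j, motive (toStarUnit j)) (j : (starUnit (Psh V)).el Y) : motive j := h j

theorem toStarUnit_eq {X : V} (j : X ⟶ starUnit V) :
    toStarUnit j = res j (toStarUnit (𝟙 (starUnit V))) := by
  rw [res_toStarUnit, Category.comp_id]

theorem app_starLeftUnitor {P : Psh V} {Y Z : V} (j : Y ⟶ starUnit V) (p : P.el Z) :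
    app (starLeftUnitor P).hom (κs (toStarUnit j) p) =
      res ((j ⋆ₘ 𝟙 Z) ≫ (starLeftUnitor Z).hom) p :=
  @app_dayLeftUnitor V _ S.star P Y Z j p

theorem app_starRightUnitor {P : Psh V} {Y Z : V} (p : P.el Y) (j : Z ⟶ starUnit V) :
    app (starRightUnitor P).hom (κs p (toStarUnit j)) =
      res ((𝟙 Y ⋆ₘ j) ≫ (starRightUnitor Y).hom) p :=
  @app_dayRightUnitor V _ S.star P Y Z p j

/-- The presheaf `T (- ⋆ Z)`. -/
def starShiftR (T : Psh V) (Z : V) : Psh V := @shiftR V _ S.star T Z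

/-- The presheaf `T (Z ⋆ -)`. -/
def starShiftL (T : Psh V) (Z : V) : Psh V := @shiftL V _ S.star T Z

/-- An element of `T (X ⋆ Z)`, as an element of `starShiftR T Z`. -/
def toStarShiftR {T : Psh V} {X Z : V} (s : T.el (X ⋆ Z)) : (starShiftR T Z).el X := s

/-- An element of `starShiftR T Z`, as an element of `T (X ⋆ Z)`. -/
def ofStarShiftR {T : Psh V} {X Z : V} (s : (starShiftR T Z).el X) : T.el (X ⋆ Z) := s

/-- An element of `T (Z ⋆ X)`, as an element of `starShiftL T Z`. -/
def toStarShiftL {T : Psh V} {X Z : V} (s : T.el (Z ⋆ X)) : (starShiftL T Z).el X := s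

/-- An element of `starShiftL T Z`, as an element of `T (Z ⋆ X)`. -/
def ofStarShiftL {T : Psh V} {X Z : V} (s : (starShiftL T Z).el X) : T.el (Z ⋆ X) := s

theorem ofStarShiftR_res {T : Psh V} {Z X Y : V} (f : Y ⟶ X) (s : (starShiftR T Z).el X) :
    ofStarShiftR (res f s) = res (f ⋆ₘ 𝟙 Z) (ofStarShiftR s) := rfl

theorem ofStarShiftL_res {T : Psh V} {Z X Y : V} (f : Y ⟶ X) (s : (starShiftL T Z).el X) :
    ofStarShiftL (res f s) = res (𝟙 Z ⋆ₘ f) (ofStarShiftL s) := rfl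

theorem res_toStarShiftR {T : Psh V} {Z X Y : V} (f : Y ⟶ X) (s : T.el (X ⋆ Z)) :
    res f (toStarShiftR s) = toStarShiftR (res (f ⋆ₘ 𝟙 Z) s) := rfl

theorem res_toStarShiftL {T : Psh V} {Z X Y : V} (f : Y ⟶ X) (s : T.el (Z ⋆ X)) :
    res f (toStarShiftL s) = toStarShiftL (res (𝟙 Z ⋆ₘ f) s) := rfl

theorem ofStarShiftR_toStarShiftR {T : Psh V} {X Z : V} (s : T.el (X ⋆ Z)) :
    ofStarShiftR (toStarShiftR s) = s := rfl

theorem ofStarShiftL_toStarShiftL {T : Psh V} {X Z : V} (s : T.el (Z ⋆ X)) :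
    ofStarShiftL (toStarShiftL s) = s := rfl

end Star

section Duoidal

variable [MonoidalCategory V] [StarMonoidal V]

section

variable {P Q R S T : Psh V}
  (t : ∀ A B C D : V, P.el A → Q.el B → R.el C → S.el D → T.el ((A ⊗ B) ⋆ (C ⊗ D)))
  (ht : ∀ (A B C D A₁ B₁ C₁ D₁ : V) (a : A₁ ⟶ A) (b : B₁ ⟶ B) (c : C₁ ⟶ C) (d : D₁ ⟶ D)
    (p : P.el A) (q : Q.el B) (r : R.el C) (s : S.el D),
    t _ _ _ _ (res a p) (res b q) (res c r) (res d s) =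
      res ((a ⊗ₘ b) ⋆ₘ (c ⊗ₘ d)) (t _ _ _ _ p q r s))

/-- Auxiliary to `descX`. -/
def descX₁ {A B : V} (p : P.el A) (q : Q.el B) : R ⊗ S ⟶ starShiftL T (A ⊗ B) :=
  desc₀ (fun _ _ r s => toStarShiftL (t _ _ _ _ p q r s)) (fun _ _ _ _ c d r s => by
    have := ht _ _ _ _ _ _ _ _ (𝟙 A) (𝟙 B) c d p q r s
    rw [res_id, res_id, id_tensorHom_id] at this
    rw [this, res_toStarShiftL])

theorem app_descX₁ {A B C D : V} (p : P.el A) (q : Q.el B) (r : R.el C) (s : S.el D) :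
    app (descX₁ t ht p q) (κ r s) = toStarShiftL (t _ _ _ _ p q r s) :=
  app_desc₀ _ _ _ _

/-- Auxiliary to `descX`. -/
def descX₂ {X : V} (z : (R ⊗ S).el X) : P ⊗ Q ⟶ starShiftR T X :=
  desc₀ (fun _ _ p q => toStarShiftR (ofStarShiftL (app (descX₁ t ht p q) z)))
    (fun _ _ _ _ a b p q => by
      obtain ⟨C, D, f, r, s, rfl⟩ := exists_rep z
      have := ht _ _ _ _ _ _ _ _ a b (𝟙 C) (𝟙 D) p q r s
      rw [res_id, res_id, id_tensorHom_id] at this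
      rw [res_toStarShiftR, app_res, app_res, app_descX₁, app_descX₁, ofStarShiftL_res,
        ofStarShiftL_res, ofStarShiftL_toStarShiftL, ofStarShiftL_toStarShiftL, this, res_res,
        res_res, Duoidal.starHom_comp, Duoidal.starHom_comp]
      simp only [Category.comp_id, Category.id_comp])

theorem app_descX₂ {A B X : V} (p : P.el A) (q : Q.el B) (z : (R ⊗ S).el X) :
    app (descX₂ t ht z) (κ p q) = toStarShiftR (ofStarShiftL (app (descX₁ t ht p q) z)) :=
  app_desc₀ _ _ _ _

/-- The morphism out of `(P ⊗ Q) ⋆ (R ⊗ S)` given by a natural family of maps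
`P A × Q B × R C × S D → T ((A ⊗ B) ⋆ (C ⊗ D))`. -/
def descX : (P ⊗ Q) ⋆ (R ⊗ S) ⟶ T :=
  starDesc (fun _ _ z w => ofStarShiftR (app (descX₂ t ht w) z)) (fun _ _ _ _ f g z w => by
    obtain ⟨A, B, h, p, q, rfl⟩ := exists_rep z
    rw [res_res, app_res, app_res, ofStarShiftR_res, ofStarShiftR_res, app_descX₂, app_descX₂,
      ofStarShiftR_toStarShiftR, ofStarShiftR_toStarShiftR, app_res, ofStarShiftL_res, res_res,
      res_res, Duoidal.starHom_comp, Duoidal.starHom_comp]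
    simp only [Category.comp_id, Category.id_comp])

theorem app_descX {A B C D : V} (p : P.el A) (q : Q.el B) (r : R.el C) (s : S.el D) :
    app (descX t ht) (κs (κ p q) (κ r s)) = t _ _ _ _ p q r s := by
  rw [descX, app_starDesc, app_descX₂, app_descX₁, ofStarShiftR_toStarShiftR,
    ofStarShiftL_toStarShiftL]

end

variable [Duoidal V]

/-- The interchanger of `V̂`. -/
def dayξ (P Q R S : Psh V) : (P ⊗ Q) ⋆ (R ⊗ S) ⟶ (P ⋆ R) ⊗ (Q ⋆ S) :=
  descX (fun _ _ _ _ p q r s => res (Duoidal.ξ _ _ _ _) (κ (κs p r) (κs q s)))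
    (fun _ _ _ _ _ _ _ _ a b c d p q r s => by
      rw [κs_res, κs_res, κ_res, res_res, res_res, Duoidal.ξ_natural])

theorem app_dayξ {P Q R S : Psh V} {A B C D : V} (p : P.el A) (q : Q.el B) (r : R.el C)
    (s : S.el D) : app (dayξ P Q R S) (κs (κ p q) (κ r s)) =
      res (Duoidal.ξ _ _ _ _) (κ (κs p r) (κs q s)) := by
  rw [dayξ, app_descX]

variable (V)

/-- The morphism `I ⋆ I ⟶ I` of `V̂`. -/
def dayμ : 𝟙_ (Psh V) ⋆ 𝟙_ (Psh V) ⟶ 𝟙_ (Psh V) :=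
  starDesc (fun _ _ i j => toUnit ((ofUnit i ⋆ₘ ofUnit j) ≫ Duoidal.μ))
    (fun _ _ _ _ a b i j => by
      rw [res_toUnit, ofUnit_res, ofUnit_res, Duoidal.starHom_comp_assoc])

/-- The morphism `J ⟶ I` of `V̂`. -/
def dayν : starUnit (Psh V) ⟶ 𝟙_ (Psh V) := yoMap (Duoidal.ν : starUnit V ⟶ 𝟙_ V)

/-- The morphism `J ⟶ J ⊗ J` of `V̂`. -/
def dayγ : starUnit (Psh V) ⟶ starUnit (Psh V) ⊗ starUnit (Psh V) :=
  homMk (fun j => res (ofStarUnit j ≫ Duoidal.γ)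
      (κ (toStarUnit (𝟙 (starUnit V))) (toStarUnit (𝟙 (starUnit V)))))
    (fun f j => by rw [ofStarUnit_res, res_res, Category.assoc])

variable {V}

theorem app_dayμ {X Y : V} (i : X ⟶ 𝟙_ V) (j : Y ⟶ 𝟙_ V) :
    app (dayμ V) (κs (toUnit i) (toUnit j)) = toUnit ((i ⋆ₘ j) ≫ Duoidal.μ) := by
  rw [dayμ, app_starDesc, ofUnit_toUnit, ofUnit_toUnit]

theorem app_dayν {X : V} (j : X ⟶ starUnit V) :
    app (dayν V) (toStarUnit j) = toUnit (j ≫ Duoidal.ν) := rfl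

theorem app_dayγ {X : V} (j : X ⟶ starUnit V) : app (dayγ V) (toStarUnit j) =
    res (j ≫ Duoidal.γ) (κ (toStarUnit (𝟙 (starUnit V))) (toStarUnit (𝟙 (starUnit V)))) := rfl

instance : Duoidal (Psh V) where
  ξ := dayξ
  μ := dayμ V
  ν := dayν V
  γ := dayγ V
  ξ_natural f g h k := star_ext fun Y Z s t => by
    obtain ⟨A, B, a, p, q, rfl⟩ := exists_rep s
    obtain ⟨C, D, b, r, s, rfl⟩ := exists_rep t
    simp only [κs_res, app_res, app_comp, app_starHom, app_tensorHom, app_dayξ]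
  ξ_assoc P Q R P₁ Q₁ R₁ := star_ext fun Y Z s t => by
    obtain ⟨A, B, a, s, r, rfl⟩ := exists_rep s
    obtain ⟨A, B, a, p, q, rfl⟩ := exists_rep s
    obtain ⟨C, D, b, t, r₁, rfl⟩ := exists_rep t
    obtain ⟨C, D, b, p₁, q₁, rfl⟩ := exists_rep t
    simp only [κ_res_left, κ_res_right, κs_res, app_res, app_comp, app_starHom, app_whiskerLeft,
      app_whiskerRight, app_associator, app_dayξ, res_res]
    rw [id_tensorHom, Duoidal.ξ_assoc, ← tensorHom_id]
  ξ_leftUnit P Q := star_ext fun Y Z s t => by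
    obtain ⟨A, B, a, i, p, rfl⟩ := exists_rep s
    obtain ⟨C, D, b, j, q, rfl⟩ := exists_rep t
    induction i using unit_cases with | h i
    induction j using unit_cases with | h j
    simp only [κs_res, app_res, app_comp, app_starHom, app_whiskerRight, app_leftUnitor, app_dayξ,
      app_dayμ, res_res]
    congr 2
    rw [← Duoidal.starHom_comp, ← Duoidal.ξ_leftUnit, Duoidal.ξ_natural_assoc, ← tensorHom_id,
      tensorHom_comp_tensorHom_assoc, Duoidal.starHom_id, Category.id_comp]
  ξ_rightUnit P Q := star_ext fun Y Z s t => by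
    obtain ⟨A, B, a, p, i, rfl⟩ := exists_rep s
    obtain ⟨C, D, b, q, j, rfl⟩ := exists_rep t
    induction i using unit_cases with | h i
    induction j using unit_cases with | h j
    simp only [κs_res, app_res, app_comp, app_starHom, app_whiskerLeft, app_rightUnitor, app_dayξ,
      app_dayμ, res_res]
    congr 2
    rw [← Duoidal.starHom_comp, ← Duoidal.ξ_rightUnit, Duoidal.ξ_natural_assoc, ← id_tensorHom,
      tensorHom_comp_tensorHom_assoc, Duoidal.starHom_id, Category.id_comp]
  γ_coassoc := hom_ext fun X j => by
    induction j using starUnit_cases with | h j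
    simp only [app_res, app_comp, app_whiskerLeft, app_whiskerRight, app_associator, app_dayγ,
      κ_res_left, κ_res_right, res_res]
    simp only [Category.id_comp, Category.assoc, id_tensorHom, tensorHom_id, Duoidal.γ_coassoc]
  γ_counit_left := hom_ext fun X j => by
    induction j using starUnit_cases with | h j
    simp only [app_res, app_comp, app_whiskerRight, app_leftUnitor, app_dayγ,
      app_dayν, res_res, app_id]
    rw [toStarUnit_eq j]
    simp only [Category.id_comp, Category.assoc, tensorHom_id, Duoidal.γ_counit_left,
      Category.comp_id]
  γ_counit_right := hom_ext fun X j => by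
    induction j using starUnit_cases with | h j
    simp only [app_res, app_comp, app_whiskerLeft, app_rightUnitor, app_dayγ,
      app_dayν, res_res, app_id]
    rw [toStarUnit_eq j]
    simp only [Category.id_comp, Category.assoc, id_tensorHom, Duoidal.γ_counit_right,
      Category.comp_id]
  starAssoc_ξ P Q P₁ Q₁ P₂ Q₂ := star_ext fun Y Z s t => by
    obtain ⟨A, B, a, s, s₁, rfl⟩ := exists_rep_star s
    obtain ⟨A, B, a, p, q, rfl⟩ := exists_rep s
    obtain ⟨A, B, a, p₁, q₁, rfl⟩ := exists_rep s₁
    obtain ⟨A, B, a, p₂, q₂, rfl⟩ := exists_rep t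
    simp only [κs_res_left, κs_res_right, app_res, app_comp, app_starHom, app_tensorHom,
      app_starAssoc, app_dayξ, res_res, app_id]
    rw [κ_res, res_res]
    simp only [Category.assoc, Duoidal.starAssoc_ξ]
  starAssoc_μ := star_ext fun Y Z s k => by
    obtain ⟨A, B, a, i, j, rfl⟩ := exists_rep_star s
    induction i using unit_cases with | h i
    induction j using unit_cases with | h j
    induction k using unit_cases with | h k
    simp only [κs_res_left, app_res, app_comp, app_starHom, app_starAssoc, app_dayμ,
      app_id, res_toUnit]
    have e1 : (((i ⋆ₘ j) ≫ Duoidal.μ) ⋆ₘ k) = ((i ⋆ₘ j) ⋆ₘ k) ≫ (Duoidal.μ ⋆ₘ 𝟙 _) := by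
      rw [Duoidal.starHom_comp, Category.comp_id]
    have e2 : (i ⋆ₘ ((j ⋆ₘ k) ≫ Duoidal.μ)) = (i ⋆ₘ (j ⋆ₘ k)) ≫ (𝟙 _ ⋆ₘ Duoidal.μ) := by
      rw [Duoidal.starHom_comp, Category.comp_id]
    have e3 : ((i ⋆ₘ j) ⋆ₘ k) ≫ (starAssoc (𝟙_ V) (𝟙_ V) (𝟙_ V)).hom =
        (starAssoc A B Z).hom ≫ (i ⋆ₘ (j ⋆ₘ k)) :=
      @MonoidalCategory.associator_naturality V _ StarMonoidal.star _ _ _ _ _ _ i j k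
    rw [e1, e2, Category.assoc, Category.assoc, Duoidal.starAssoc_μ, reassoc_of% e3]
  starLeftUnitor_ξ P Q := star_ext fun Y Z j t => by
    obtain ⟨A, B, a, p, q, rfl⟩ := exists_rep t
    induction j using starUnit_cases with | h j
    simp only [κs_res_left, κs_res_right, app_res, app_comp, app_starHom, app_tensorHom,
      app_starLeftUnitor, app_dayξ, app_dayγ, res_res, app_id]
    rw [κ_res, res_res, ← Duoidal.starLeftUnitor_ξ, Duoidal.starHom_comp_assoc (j),
      Duoidal.starHom_id, Duoidal.starHom_id]
    simp only [Category.id_comp, Category.assoc]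
  starLeftUnitor_μ := star_ext fun Y Z j i => by
    induction i using unit_cases with | h i
    induction j using starUnit_cases with | h j
    simp only [app_comp, app_starHom, app_dayν, app_starLeftUnitor, app_dayμ, app_id, res_toUnit]
    rw [Category.assoc, ← Duoidal.starLeftUnitor_natural, ← Duoidal.starLeftUnitor_μ,
      Duoidal.starHom_comp_assoc, Duoidal.starHom_comp_assoc]
    simp only [Category.id_comp, Category.comp_id]
  starRightUnitor_ξ P Q := star_ext fun Y Z t j => by
    obtain ⟨A, B, a, p, q, rfl⟩ := exists_rep t
    induction j using starUnit_cases with | h j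
    simp only [κs_res_left, κs_res_right, app_res, app_comp, app_starHom, app_tensorHom,
      app_starRightUnitor, app_dayξ, app_dayγ, res_res, app_id]
    rw [κ_res, res_res, ← Duoidal.starRightUnitor_ξ, Duoidal.starHom_comp_assoc (𝟙 (A ⊗ B)) _ j,
      Duoidal.starHom_id, Duoidal.starHom_id]
    simp only [Category.id_comp, Category.assoc]
  starRightUnitor_μ := star_ext fun Y Z i j => by
    induction i using unit_cases with | h i
    induction j using starUnit_cases with | h j
    simp only [app_comp, app_starHom, app_dayν, app_starRightUnitor, app_dayμ, app_id, res_toUnit]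
    rw [Category.assoc, ← Duoidal.starRightUnitor_natural, ← Duoidal.starRightUnitor_μ,
      Duoidal.starHom_comp_assoc, Duoidal.starHom_comp_assoc]
    simp only [Category.id_comp, Category.comp_id]

instance : StarBiclosed (Psh V) where
  left P := @isLeftAdjoint_tensorLeft V _ StarMonoidal.star P
  right P := @isLeftAdjoint_tensorRight V _ StarMonoidal.star P

instance [Duoidal.IsNormal V] : Duoidal.IsNormal (Psh V) where
  isIso_ν := by
    refine ⟨yoMap (inv (Duoidal.ν : starUnit V ⟶ 𝟙_ V)), hom_ext fun X j => ?_,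
      hom_ext fun X j => ?_⟩
    · change (ofStarUnit j ≫ Duoidal.ν) ≫ inv Duoidal.ν = ofStarUnit j
      simp
    · change (ofUnit j ≫ inv Duoidal.ν) ≫ Duoidal.ν = ofUnit j
      simp

end Duoidal

end Psh

/-- The `V`-graded category given by a `V̂`-category, in elementary terms: a graded morphism
`A ⟶ B` of grade `X` is an element of `C(A, B)(X)`, and the composite `g ∘ f` is the image of the
class of `(𝟙, g, f)` under the composition morphism `C(B, D) ⊗ C(A, B) ⟶ C(A, D)`. -/
def VCat.elements [MonoidalCategory V] (C : VCat (Psh V)) : GradedCat V where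
  Obj := C.Obj
  Hom X A B := (C.Hom A B).el X
  reindex α f := Psh.res α f
  comp {X Y A B D} g f := Psh.app (C.comp A B D) (Psh.κ g f)
  id A := Psh.app (C.id A) (Psh.toUnit (𝟙 (𝟙_ V)))
  reindex_id f := Psh.res_id f
  reindex_reindex α β f := Psh.res_res α β f
  comp_reindex β α g f := by rw [Psh.κ_res, Psh.app_res]
  assoc {X Y Z A B C₁ D} h g f := by
    have := congrArg (fun θ => Psh.app θ (Psh.κ (Psh.κ h g) f)) (C.assoc A B C₁ D)
    simpa only [Psh.app_comp, Psh.app_whiskerRight, Psh.app_whiskerLeft, Psh.app_associator,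
      Psh.app_res] using this
  comp_id {X A B} f := by
    have := congrArg (fun θ => Psh.app θ (Psh.κ f (Psh.toUnit (𝟙 (𝟙_ V))))) (C.comp_id A B)
    simpa only [Psh.app_comp, Psh.app_whiskerLeft, Psh.app_rightUnitor, id_tensorHom_id,
      Category.id_comp] using this
  id_comp {X A B} f := by
    have := congrArg (fun θ => Psh.app θ (Psh.κ (Psh.toUnit (𝟙 (𝟙_ V))) f)) (C.id_comp A B)
    simpa only [Psh.app_comp, Psh.app_whiskerRight, Psh.app_leftUnitor, id_tensorHom_id,
      Category.id_comp] using this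

end Day

end
end DuoidalGraded

open DuoidalGraded

namespace DuoidalGraded

open Duoidal

noncomputable section

/-! ### `V`-functors as graded functors -/

section Enriched

variable {V : Type u} [Category.{v} V] [MonoidalCategory V]

/-! Both parts are Yoneda arguments, resting on the stability of graded squares under reindexing
(`GradedCat.IsSquare.reindex`).

Let `A` be a `V`-category regarded as graded. Each hom-object `A(a, b)` carries a universal graded
morphism from `a` to `b`, namely its identity, and every graded morphism `f : X ⟶ A(a, b)` is the
reindexing of the universal one along `f`. Two consequences follow. A graded functor is determined
by its values on the universal morphisms, and these values are the components of a `V`-functor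
(`VFunctor.toGraded_bijective`). A family `φ` forms squares with all graded morphisms of `A` as soon
as it does so with the universal ones. Transposed along the adjunctions for `⋆`, this last condition
says exactly that `φ` is a cone over the diagram of Garner and López Franco (`diagramR_condition`,
`diagramL_condition`), so the families of grade `X` correspond to the morphisms from `X` to the
limit. Composition and identities of the enriched functor category are determined by the projections
to `C`, hence agree with the objectwise ones; `tensorHom_comp_of_eq` handles composition, for
functors and for projections alike.

Over `V̂` the hom-objects are presheaves while the grades remain objects of `V`, so the second part
applied to `V̂` would not give the first: it concerns grades in `V̂`. The same argument is instead
run on elements, an element at `X` being a morphism out of the representable presheaf on `X`. The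
bridge is `Psh.isSquare_iff`. A morphism out of `P ⋆ Q` is determined by its values on the
generators `κs p q`, and on these the `σ` and `τ` of `V̂` are given by reindexing along the `σ` and
`τ` of `V` (`Psh.app_σ`, `Psh.app_τ`). A square in a `V̂`-category is therefore a family of
`V`-graded squares of elements, and the cone condition defining the limit in `V̂` becomes the
condition defining the graded functor category.

The `r` and `ℓ` versions differ only in which pair of sides of the square belongs to the family and
which to the functors. -/

theorem tensorHom_comp_of_eq {P Q R S T U X Y : V} {m : P ⊗ Q ⟶ R} {θ : R ⟶ S} {α : P ⟶ T}
    {β : Q ⟶ U} {n : T ⊗ U ⟶ S} (h : m ≫ θ = (α ⊗ₘ β) ≫ n) (g : Y ⟶ P) (f : X ⟶ Q) :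
    ((g ⊗ₘ f) ≫ m) ≫ θ = ((g ≫ α) ⊗ₘ (f ≫ β)) ≫ n := by
  rw [Category.assoc, h, tensorHom_comp_tensorHom_assoc]

/-- The `V`-graded functor given by a `V`-functor. -/
def VFunctor.toGraded {A : VCat.{u, v, w} V} {C : VCat.{u, v, y} V} (F : VFunctor A C) :
    GradedFunctor A.toGraded C.toGraded where
  obj := F.obj
  map {_ a b} f := f ≫ F.map a b
  map_reindex α f := Category.assoc α f _
  -- The graded composite of `g` and `f` is `g ⊗ₘ f` followed by composition, so the graded law is
  -- the enriched one precomposed with `g ⊗ₘ f`.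
  map_comp {_ _ a b c} g f := tensorHom_comp_of_eq (F.map_comp a b c) g f
  map_id a := F.map_id a

/-- The `V`-functor given by a `V`-graded functor between `V`-categories. -/
def VFunctor.ofGraded {A : VCat.{u, v, w} V} {C : VCat.{u, v, y} V}
    (F : GradedFunctor A.toGraded C.toGraded) : VFunctor A C where
  obj := F.obj
  -- The value of `F` on the universal graded morphism, which has grade `A(a, b)`.
  map a b := F.map (X := A.Hom a b) (𝟙 (A.Hom a b))
  map_id a := by
    -- Precomposition is reindexing, so the left side is `F` applied to the reindexing of the
    -- universal morphism along `A.id a`, which is the graded identity of `a`.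
    refine (F.map_reindex (A.id a) (𝟙 (A.Hom a a))).symm.trans ?_
    refine (congrArg F.map ?_).trans (F.map_id a)
    exact Category.comp_id _
  map_comp a b c := by
    refine (F.map_reindex (A.comp a b c) (𝟙 (A.Hom a c))).symm.trans ?_
    -- As a graded morphism, `A.comp a b c` is the composite of two universal morphisms, so the
    -- enriched law is this one instance of the graded law.
    refine (congrArg F.map ?_).trans
      (F.map_comp (X := A.Hom a b) (Y := A.Hom b c) (𝟙 (A.Hom b c)) (𝟙 (A.Hom a b)))
    change A.comp a b c ≫ 𝟙 _ = (𝟙 _ ⊗ₘ 𝟙 _) ≫ A.comp a b c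
    rw [id_tensorHom_id, Category.comp_id, Category.id_comp]

/-- The Yoneda lemma on each hom-object: a family of maps compatible with reindexing is the same as
its value on the identity. The functor laws play no further role, since only the actions on
morphisms have to be compared. -/
theorem VFunctor.toGraded_bijective {A : VCat.{u, v, w} V} {C : VCat.{u, v, y} V} :
    Function.Bijective (VFunctor.toGraded (A := A) (C := C)) := by
  refine Function.bijective_iff_has_inverse.2 ⟨VFunctor.ofGraded, fun F => ?_, fun F => ?_⟩
  · have h : ∀ a b, (ofGraded F.toGraded).map a b = F.map a b := fun a b => Category.id_comp _
    change VFunctor.mk F.obj (ofGraded F.toGraded).map _ _ = VFunctor.mk F.obj F.map _ _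
    congr 1
    exact funext fun a => funext fun b => h a b
  · have h : ∀ (X : V) (a b : A.Obj) (f : X ⟶ A.Hom a b),
        (ofGraded F).toGraded.map f = F.map (X := X) f := fun X a b f => by
      -- Any `f` is the universal morphism reindexed along `f` itself, so `F` is recovered from its
      -- values on universal morphisms.
      refine (F.map_reindex f (𝟙 (A.Hom a b))).symm.trans (congrArg F.map ?_)
      exact Category.comp_id f
    change GradedFunctor.mk F.obj (ofGraded F).toGraded.map _ _ _ =
      GradedFunctor.mk F.obj F.map _ _ _
    congr 1
    funext X a b f
    exact h X a b f

/-! ### Enriched against graded functor categories over a complete biclosed `V` -/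

variable [StarMonoidal V] [Duoidal V] [IsNormal V] [StarBiclosed V] [HasLimitsOfSize.{w, w} V]

/-- The isomorphism `[A, C]_r^V ≅ [A, C]_r`. -/
def GLF.rightIso (A : VCat.{u, v, w} V) (C : VCat.{u, v, y} V) :
    GradedIso (GLF.right A C).toGraded (GradedCat.funR A.toGraded C.toGraded) where
  obj := VFunctor.toGraded
  -- The limit cone gives squares for the universal morphisms; reindexing along `f` and `h` gives
  -- the square for an arbitrary `f` and the family determined by `h`.
  map {X F G} h := ⟨fun a => h ≫ projR F G a, fun _ a b f =>
    (projR_isSquare F G a b).reindex f h⟩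
  map_reindex α h := Subtype.ext (funext fun a => Category.assoc _ _ _)
  map_comp {X Y F G H} k h := Subtype.ext (funext fun a =>
    tensorHom_comp_of_eq (compR_proj F G H a) k h)
  map_id F := Subtype.ext (funext fun a => idR_proj F a)
  obj_bijective := VFunctor.toGraded_bijective
  map_bijective X F G := by
    refine ⟨fun h k e => homR_ext fun a => congrFun (congrArg Subtype.val e) a, fun φ => ?_⟩
    have hφ : ∀ a b, C.toGraded.IsSquare (F.map a b) (G.map a b) (φ.1 a) (φ.1 b) := fun a b => by
      -- Conversely, the square for the universal morphism alone is the cone condition.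
      have := φ.2 (A.Hom a b) a b (𝟙 (A.Hom a b))
      simp only [VFunctor.toGraded, Category.id_comp] at this
      exact this
    exact ⟨liftR φ.1 hφ, Subtype.ext (funext fun a => liftR_proj φ.1 hφ a)⟩

/-- The isomorphism `[A, C]_ℓ^V ≅ [A, C]_ℓ`. -/
def GLF.leftIso (A : VCat.{u, v, w} V) (C : VCat.{u, v, y} V) :
    GradedIso (GLF.left A C).toGraded (GradedCat.funL A.toGraded C.toGraded) where
  obj := VFunctor.toGraded
  -- Here the family occupies the first pair of sides of the square, so `h` and `f` reindex in the
  -- opposite order.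
  map {X F G} h := ⟨fun a => h ≫ projL F G a, fun _ a b f =>
    (projL_isSquare F G a b).reindex h f⟩
  map_reindex α h := Subtype.ext (funext fun a => Category.assoc _ _ _)
  map_comp {X Y F G H} k h := Subtype.ext (funext fun a =>
    tensorHom_comp_of_eq (compL_proj F G H a) k h)
  map_id F := Subtype.ext (funext fun a => idL_proj F a)
  obj_bijective := VFunctor.toGraded_bijective
  map_bijective X F G := by
    refine ⟨fun h k e => homL_ext fun a => congrFun (congrArg Subtype.val e) a, fun φ => ?_⟩
    have hφ : ∀ a b, C.toGraded.IsSquare (φ.1 a) (φ.1 b) (F.map a b) (G.map a b) := fun a b => by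
      have := φ.2 (A.Hom a b) a b (𝟙 (A.Hom a b))
      simp only [VFunctor.toGraded, Category.id_comp] at this
      exact this
    exact ⟨liftL φ.1 hφ, Subtype.ext (funext fun a => liftL_proj φ.1 hφ a)⟩

end Enriched

section Day

variable {V : Type u} [SmallCategory V]

/-! ### The Yoneda lemma and generators of Day convolutions -/

namespace Psh

/-- The morphism out of a representable presheaf given by an element. -/
def yoHom {P : Psh V} {X : V} (p : P.el X) : yo X ⟶ P :=
  homMk (fun f => res (ofEl f) p) (fun f g => by rw [ofEl_res, res_res])

theorem app_yoHom {P : Psh V} {X Y : V} (p : P.el X) (f : Y ⟶ X) :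
    app (yoHom p) (toEl f) = res f p := rfl

/-- Naturality of the Yoneda correspondence in the presheaf. Together with `yoHom_injective` it
turns equations between elements into equations between morphisms, to which the universal property
of a limit in `V̂` applies. -/
theorem yoHom_comp {P Q : Psh V} {X : V} (p : P.el X) (θ : P ⟶ Q) :
    yoHom p ≫ θ = yoHom (app θ p) :=
  hom_ext fun _ f => app_res θ (ofEl f) p

theorem yoHom_injective {P : Psh V} {X : V} {p q : P.el X} (h : yoHom p = yoHom q) : p = q := by
  have := congrArg (fun θ => app θ (toEl (𝟙 X))) h
  simpa only [app_yoHom, res_id] using this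

variable [MonoidalCategory V]

/-- The inverse unitors of Day convolution were defined by pairing with the identity of `I`. These
formulas start the evaluation of `σ` and `τ`. -/
theorem app_leftUnitor_inv {P : Psh V} {X : V} (p : P.el X) :
    app (λ_ P).inv p = res (λ_ X).inv (κ (toUnit (𝟙 (𝟙_ V))) p) := rfl

theorem app_rightUnitor_inv {P : Psh V} {X : V} (p : P.el X) :
    app (ρ_ P).inv p = res (ρ_ X).inv (κ p (toUnit (𝟙 (𝟙_ V)))) := rfl

/-- The analogue on elements of `tensorHom_comp_of_eq`: both the composition law of a `V̂`-functor
and that of the projections have the shape of `h`, and evaluation at `κ g f` yields the graded law.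
-/
theorem app_comp_of_eq {P Q R S T U : Psh V} {m : P ⊗ Q ⟶ R} {θ : R ⟶ S} {α : P ⟶ T}
    {β : Q ⟶ U} {n : T ⊗ U ⟶ S} (h : m ≫ θ = (α ⊗ₘ β) ≫ n) {X Y : V} (g : P.el Y) (f : Q.el X) :
    app θ (app m (κ g f)) = app n (κ (app α g) (app β f)) := by
  rw [← app_comp, h, app_comp, app_tensorHom]

/-! ### The interchanger, `σ` and `τ` of `V̂` on generators -/

variable [StarMonoidal V] [Duoidal V]

theorem app_ξ {P Q R S : Psh V} {A B C D : V} (p : P.el A) (q : Q.el B) (r : R.el C)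
    (s : S.el D) : app (ξ P Q R S) (κs (κ p q) (κ r s)) =
      res (ξ A B C D) (κ (κs p r) (κs q s)) :=
  app_dayξ p q r s

variable [IsNormal V]

/-- The inverse is given only abstractly in `V̂`, but `toUnit j` is the image under `ν` of the
right-hand side, so applying the inverse cancels `ν`. -/
theorem app_inv_ν {X : V} (j : X ⟶ 𝟙_ V) :
    app (inv (ν : starUnit (Psh V) ⟶ 𝟙_ (Psh V))) (toUnit j) =
      toStarUnit (j ≫ inv (ν : starUnit V ⟶ 𝟙_ V)) := by
  have h : toUnit j = app (ν : starUnit (Psh V) ⟶ 𝟙_ (Psh V))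
      (toStarUnit (j ≫ inv (ν : starUnit V ⟶ 𝟙_ V))) := by
    refine Eq.trans ?_ (app_dayν _).symm
    simp
  rw [h, ← app_comp, IsIso.hom_inv_id, app_id]

theorem app_lI {P : Psh V} {Y Z : V} (j : Y ⟶ 𝟙_ V) (p : P.el Z) :
    app (lI P) (κs (toUnit j) p) = res ((j ⋆ₘ 𝟙 Z) ≫ lI Z) p := by
  rw [lI, app_comp, app_starHom, app_inv_ν, app_id, app_starLeftUnitor, lI, starHom_comp_assoc,
    Category.comp_id]

theorem app_rI {P : Psh V} {Y Z : V} (p : P.el Y) (j : Z ⟶ 𝟙_ V) :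
    app (rI P) (κs p (toUnit j)) = res ((𝟙 Y ⋆ₘ j) ≫ rI Y) p := by
  rw [rI, app_comp, app_starHom, app_inv_ν, app_id, app_starRightUnitor, rI, starHom_comp_assoc,
    Category.comp_id]

/-- The inverse unitors pair `p` and `q` with the identity of `I`, the interchanger of `V̂`
reindexes along `ξ`, and `rI`, `lI` absorb the two units again. Collected, the reindexings form the
composite that defines `σ Y Z`. -/
theorem app_σ {P Q : Psh V} {Y Z : V} (p : P.el Y) (q : Q.el Z) :
    app (σ P Q) (κs p q) = res (σ Y Z) (κ p q) := by
  rw [σ, app_comp, app_comp, app_starHom, app_leftUnitor_inv, app_rightUnitor_inv, κs_res, app_res,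
    app_res, app_ξ, app_res, app_tensorHom, app_lI, app_rI, κ_res, res_res, res_res, starHom_id,
    starHom_id, Category.id_comp, Category.id_comp, σ, Category.assoc]

/-- The computation is that of `app_σ`, with the units inserted on the other sides, whence the
exchange of `p` and `q`. -/
theorem app_τ {P Q : Psh V} {Y Z : V} (p : P.el Y) (q : Q.el Z) :
    app (τ P Q) (κs p q) = res (τ Y Z) (κ q p) := by
  rw [τ, app_comp, app_comp, app_starHom, app_leftUnitor_inv, app_rightUnitor_inv, κs_res, app_res,
    app_res, app_ξ, app_res, app_tensorHom, app_lI, app_rI, κ_res, res_res, res_res, starHom_id,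
    starHom_id, Category.id_comp, Category.id_comp, τ, Category.assoc]

/-- Squares in a `V̂`-category can be tested on elements. -/
theorem isSquare_iff (C : VCat.{u + 1, u, y} (Psh V)) {P Q : Psh V} {a a₁ b b₁ : C.Obj}
    (f : P ⟶ C.Hom a a₁) (g : P ⟶ C.Hom b b₁) (φ : Q ⟶ C.Hom a b) (ψ : Q ⟶ C.Hom a₁ b₁) :
    C.toGraded.IsSquare f g φ ψ ↔ ∀ (X Y : V) (p : P.el X) (q : Q.el Y),
      C.elements.IsSquare (app f p) (app g p) (app φ q) (app ψ q) := by
  -- `e1` and `e2` evaluate the two sides of the square in `V̂` at a generator; the results are the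
  -- two sides of the square of elements.
  have e1 : ∀ (X Y : V) (p : P.el X) (q : Q.el Y),
      app (σ P Q ≫ (g ⊗ₘ φ) ≫ C.comp _ _ _) (κs p q) =
        res (σ X Y) (app (C.comp _ _ _) (κ (app g p) (app φ q))) := fun X Y p q => by
    rw [app_comp, app_σ, app_res, app_comp, app_tensorHom]
  have e2 : ∀ (X Y : V) (p : P.el X) (q : Q.el Y),
      app (τ P Q ≫ (ψ ⊗ₘ f) ≫ C.comp _ _ _) (κs p q) =
        res (τ X Y) (app (C.comp _ _ _) (κ (app ψ q) (app f p))) := fun X Y p q => by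
    rw [app_comp, app_τ, app_res, app_comp, app_tensorHom]
  constructor
  · intro h X Y p q
    exact (e1 X Y p q).symm.trans ((congrArg (fun θ => app θ (κs p q)) h).trans (e2 X Y p q))
  · intro h
    -- Generators suffice, since both sides are morphisms out of `P ⋆ Q`.
    exact star_ext fun X Y p q => (e1 X Y p q).trans ((h X Y p q).trans (e2 X Y p q).symm)

end Psh

/-! ### `V̂`-functors as `V`-graded functors -/

open Psh

section

variable [MonoidalCategory V]

/-- The `V`-graded functor given by a `V̂`-functor. -/
def VFunctor.elements {A : VCat.{u + 1, u, w} (Psh V)} {C : VCat.{u + 1, u, y} (Psh V)}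
    (F : VFunctor A C) : GradedFunctor A.elements C.elements where
  obj := F.obj
  map {_ a b} f := app (F.map a b) f
  map_reindex α f := app_res _ α f
  map_comp {_ _ a b c} g f := app_comp_of_eq (F.map_comp a b c) g f
  map_id a := congrArg (fun θ => app θ (toUnit (𝟙 (𝟙_ V)))) (F.map_id a)

/-- The `V̂`-functor given by a `V`-graded functor between `V̂`-categories. -/
def VFunctor.ofElements {A : VCat.{u + 1, u, w} (Psh V)} {C : VCat.{u + 1, u, y} (Psh V)}
    (F : GradedFunctor A.elements C.elements) : VFunctor A C where
  obj := F.obj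
  map a b := homMk (fun f => F.map f) (fun α f => F.map_reindex α f)
  map_id a := hom_ext fun X j => by
    induction j using unit_cases with | h j
    -- Every element `j` of the unit presheaf is the identity of `I` reindexed along `j`, and at
    -- that identity the law is `F.map_id`.
    rw [app_comp, toUnit_eq, app_res, app_res, app_res]
    exact congrArg (res j) (F.map_id a)
  -- On a generator `κ g f`, composition in a `V̂`-category is by definition the graded composite.
  map_comp a b c := tensor_ext fun Y Z g f => by
    rw [app_comp, app_comp, app_tensorHom]
    exact F.map_comp g f

/-- A morphism of hom-presheaves is a family of maps of elements with its naturality, which is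
precisely the action of a graded functor with its compatibility with reindexing. Both round trips
are therefore definitional. -/
theorem VFunctor.elements_bijective {A : VCat.{u + 1, u, w} (Psh V)}
    {C : VCat.{u + 1, u, y} (Psh V)} :
    Function.Bijective (VFunctor.elements (A := A) (C := C)) :=
  Function.bijective_iff_has_inverse.2 ⟨VFunctor.ofElements, fun _ => rfl, fun _ => rfl⟩

end

/-! ### Enriched functor categories over `V̂` against graded functor categories over `V` -/

variable [MonoidalCategory V] [StarMonoidal V] [Duoidal V] [IsNormal V]

/-- The isomorphism `[A, C]_r^V̂ ≅ [A, C]_r`. -/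
def GLF.rightElementsIso (A : VCat.{u + 1, u, u} (Psh V)) (C : VCat.{u + 1, u, y} (Psh V)) :
    GradedIso (GLF.right A C).elements (GradedCat.funR A.elements C.elements) where
  obj := VFunctor.elements
  map {X F G} h := ⟨fun a => app (projR F G a) h, fun Y a b f =>
    (isSquare_iff C _ _ _ _).1 (projR_isSquare F G a b) Y X f h⟩
  map_reindex α h := Subtype.ext (funext fun a => app_res _ α h)
  map_comp {X Y F G H} k h := Subtype.ext (funext fun a =>
    app_comp_of_eq (compR_proj F G H a) k h)
  map_id F := Subtype.ext (funext fun a =>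
    congrArg (fun θ => app θ (toUnit (𝟙 (𝟙_ V)))) (idR_proj F a))
  obj_bijective := VFunctor.elements_bijective
  map_bijective X F G := by
    -- Elements of the limit at `X` become morphisms out of the representable on `X`, so that joint
    -- monicity of the projections can be used.
    refine ⟨fun h k e => yoHom_injective (homR_ext fun a => ?_), fun φ => ?_⟩
    · exact (yoHom_comp _ _).trans
        ((congrArg yoHom (congrFun (congrArg Subtype.val e) a)).trans (yoHom_comp _ _).symm)
    · have hφ : ∀ a b, C.toGraded.IsSquare (F.map a b) (G.map a b) (yoHom (φ.1 a))
          (yoHom (φ.1 b)) := fun a b => (isSquare_iff C _ _ _ _).2 fun Y Z f g => by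
        -- An element `g` of the representable is a morphism `Z ⟶ X`, and `yoHom (φ.1 a)` sends it
        -- to the reindexing of `φ.1 a` along `g`. The squares required are therefore reindexings of
        -- those of `φ`.
        have := (φ.2 Y a b f).reindex (𝟙 Y) (ofEl g)
        rw [C.elements.reindex_id, C.elements.reindex_id] at this
        exact this
      -- The preimage is the element of the limit that corresponds under Yoneda to the morphism
      -- induced by the cone.
      refine ⟨app (liftR (fun a => yoHom (φ.1 a)) hφ) (toEl (𝟙 X)),
        Subtype.ext (funext fun a => ?_)⟩
      have := congrArg (fun θ => app θ (toEl (𝟙 X))) (liftR_proj (fun a => yoHom (φ.1 a)) hφ a)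
      exact this.trans (res_id (φ.1 a))

/-- The isomorphism `[A, C]_ℓ^V̂ ≅ [A, C]_ℓ`. -/
def GLF.leftElementsIso (A : VCat.{u + 1, u, u} (Psh V)) (C : VCat.{u + 1, u, y} (Psh V)) :
    GradedIso (GLF.left A C).elements (GradedCat.funL A.elements C.elements) where
  obj := VFunctor.elements
  map {X F G} h := ⟨fun a => app (projL F G a) h, fun Y a b f =>
    (isSquare_iff C _ _ _ _).1 (projL_isSquare F G a b) X Y h f⟩
  map_reindex α h := Subtype.ext (funext fun a => app_res _ α h)
  map_comp {X Y F G H} k h := Subtype.ext (funext fun a =>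
    app_comp_of_eq (compL_proj F G H a) k h)
  map_id F := Subtype.ext (funext fun a =>
    congrArg (fun θ => app θ (toUnit (𝟙 (𝟙_ V)))) (idL_proj F a))
  obj_bijective := VFunctor.elements_bijective
  map_bijective X F G := by
    refine ⟨fun h k e => yoHom_injective (homL_ext fun a => ?_), fun φ => ?_⟩
    · exact (yoHom_comp _ _).trans
        ((congrArg yoHom (congrFun (congrArg Subtype.val e) a)).trans (yoHom_comp _ _).symm)
    · have hφ : ∀ a b, C.toGraded.IsSquare (yoHom (φ.1 a)) (yoHom (φ.1 b)) (F.map a b)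
          (G.map a b) := fun a b => (isSquare_iff C _ _ _ _).2 fun Y Z g f => by
        -- In the `ℓ` version the representable grades the first pair of sides, so `g` reindexes
        -- there.
        have := (φ.2 Z a b f).reindex (ofEl g) (𝟙 Z)
        rw [C.elements.reindex_id, C.elements.reindex_id] at this
        exact this
      refine ⟨app (liftL (fun a => yoHom (φ.1 a)) hφ) (toEl (𝟙 X)),
        Subtype.ext (funext fun a => ?_)⟩
      have := congrArg (fun θ => app θ (toEl (𝟙 X))) (liftL_proj (fun a => yoHom (φ.1 a)) hφ a)
      exact this.trans (res_id (φ.1 a))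

end Day

end

end DuoidalGraded

theorem mainTheorem10 :
    (∀ (V : Type u) [SmallCategory V] [MonoidalCategory V] [StarMonoidal V] [Duoidal V]
        [Duoidal.IsNormal V] (A : VCat.{u + 1, u, u} (Psh V)) (C : VCat.{u + 1, u, y} (Psh V)),
      Nonempty (GradedIso (GLF.right A C).elements (GradedCat.funR A.elements C.elements)) ∧
      Nonempty (GradedIso (GLF.left A C).elements (GradedCat.funL A.elements C.elements))) ∧
    (∀ (V : Type u) [Category.{v} V] [MonoidalCategory V] [StarMonoidal V] [Duoidal V]
        [Duoidal.IsNormal V] [HasLimitsOfSize.{w, w} V] [StarBiclosed V]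
        (A : VCat.{u, v, w} V) (C : VCat.{u, v, y} V),
      Nonempty (GradedIso (GLF.right A C).toGraded (GradedCat.funR A.toGraded C.toGraded)) ∧
      Nonempty (GradedIso (GLF.left A C).toGraded (GradedCat.funL A.toGraded C.toGraded))) := by
  exact ⟨fun _ _ _ _ _ _ A C => ⟨⟨GLF.rightElementsIso A C⟩, ⟨GLF.leftElementsIso A C⟩⟩,
    fun _ _ _ _ _ _ _ _ A C => ⟨⟨GLF.rightIso A C⟩, ⟨GLF.leftIso A C⟩⟩⟩
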